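/- An affine formula on $n$ variables is a conjunction of finitely many linear equations $\sum_i a_i x_i = b$ over $\mathbb{F}_2$; it is $2$-affine if each of its equations has at most two variables (at most two nonzero coefficients $a_i$). Two assignments in $\mathbb{F}_2^n$ differ on a variable if they give it different values. Exact Differ Affine-SAT (respectively Max Differ Affine-SAT) is the following decision problem: given an affine formula $\phi$ on $n$ variables and an integer $d \ge 0$, decide whether $\phi$ has two satisfying assignments (not required to be distinct when $d=0$) that differ on exactly $d$ (respectively at least $d$) variables. Theorem. Exact Differ Affine-SAT and Max Differ Affine-SAT are both polynomial-time solvable on $2$-affine formulas. That is, for each of the two problems there are a (multi-stack) Turing machine and a polynomial $p$ such that, on every instance $(\phi,d)$ in which $\phi$ is $2$-affine, the machine halts with the correct answer after at most $p(L)$ steps, where $L$ is the length of the input string, which consists of $n$ in unary, the augmented matrix of $\phi$ over $\mathbb{F}_2$ written row by row with separators, and $d$ in binary. -/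

import Mathlib

/-- A linear equation `∑ i, coeff i * x i = rhs` over the two-element field in the variables
`x i`, `i : Fin n`. -/
structure AffineEquation (n : ℕ) where
  coeff : Fin n → ZMod 2
  rhs : ZMod 2

/-- The set of variables that occur in an equation. -/
def AffineEquation.vars {n : ℕ} (e : AffineEquation n) : Finset (Fin n) :=
  Finset.univ.filter fun i => e.coeff i ≠ 0

/-- The assignment `s` satisfies the equation `e`. -/
def AffineEquation.SatisfiedBy {n : ℕ} (e : AffineEquation n) (s : Fin n → ZMod 2) : Prop :=
  ∑ i, e.coeff i * s i = e.rhs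

/-- An affine formula on `n` variables: a (finite) conjunction of linear equations. -/
abbrev AffineFormula (n : ℕ) := List (AffineEquation n)

/-- `s` is a satisfying assignment of the affine formula `φ`. -/
def AffineFormula.SatisfiedBy {n : ℕ} (φ : AffineFormula n) (s : Fin n → ZMod 2) : Prop :=
  ∀ e ∈ φ, e.SatisfiedBy s

/-- A `k`-affine formula: each equation has at most `k` variables. -/
def AffineFormula.IsKAffine {n : ℕ} (k : ℕ) (φ : AffineFormula n) : Prop :=
  ∀ e ∈ φ, e.vars.card ≤ k

/-- An instance `(φ, d)` of Exact/Max Differ Affine-SAT, `φ` being a formula on `n` variables. -/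
structure DifferInstance where
  n : ℕ
  formula : AffineFormula n
  d : ℕ

namespace DifferInstance

/-- Yes-instances of Exact Differ Affine-SAT: there are two satisfying assignments that differ on
exactly `d` variables. -/
def ExactDiffer (I : DifferInstance) : Prop :=
  ∃ s t : Fin I.n → ZMod 2,
    I.formula.SatisfiedBy s ∧ I.formula.SatisfiedBy t ∧ hammingDist s t = I.d

/-- Yes-instances of Max Differ Affine-SAT: there are two satisfying assignments that differ on
at least `d` variables. -/
def MaxDiffer (I : DifferInstance) : Prop :=
  ∃ s t : Fin I.n → ZMod 2,
    I.formula.SatisfiedBy s ∧ I.formula.SatisfiedBy t ∧ I.d ≤ hammingDist s t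

/-- The bit of an element of the two-element field. -/
def bit (a : ZMod 2) : Bool := decide (a = 1)

/-- An equation as a row of the augmented matrix: `n` coefficient bits and the right-hand side. -/
def rowBits {n : ℕ} (e : AffineEquation n) : List Bool :=
  List.ofFn (fun i => bit (e.coeff i)) ++ [bit e.rhs]

/-- Instances as strings over the alphabet `{0, 1, #}`, the symbol `#` being `none`: one mark for
each variable, `#`, the rows of the augmented matrix, each followed by `#`, another `#`, and `d` in
binary. -/
def encode (I : DifferInstance) : List (Option Bool) :=
  List.replicate I.n (some true) ++ none ::
    (I.formula.flatMap (fun e => (rowBits e).map some ++ [none]) ++ none ::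
      (Computability.encodeNat I.d).map some)

theorem bit_injective : Function.Injective bit := by
  unfold bit; decide

theorem rowBits_injective {n : ℕ} : Function.Injective (rowBits (n := n)) := by
  rintro ⟨a, b⟩ ⟨a', b'⟩ h
  obtain ⟨h1, h2⟩ := List.append_inj h (by simp)
  have h3 := List.ofFn_injective h1
  have h4 : a = a' := funext fun i => bit_injective (congrFun h3 i)
  have h5 : b = b' := bit_injective (by simpa using h2)
  rw [h4, h5]

theorem append_none_inj : ∀ {l l' : List Bool} {r r' : List (Option Bool)},
    l.map some ++ none :: r = l'.map some ++ none :: r' → l = l' ∧ r = r'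
  | [], [], _, _, h => by simpa using h
  | [], _ :: _, _, _, h => by simp at h
  | _ :: _, [], _, _, h => by simp at h
  | a :: l, a' :: l', r, r', h => by
    simp only [List.map_cons, List.cons_append, List.cons.injEq, Option.some.injEq] at h
    obtain ⟨h1, h2⟩ := append_none_inj h.2
    exact ⟨by rw [h.1, h1], h2⟩

theorem rowBits_ne_nil {n : ℕ} (e : AffineEquation n) : rowBits e ≠ [] := by
  simp [rowBits]

theorem rows_inj {n : ℕ} : ∀ {φ φ' : AffineFormula n} {r r' : List (Option Bool)},
    φ.flatMap (fun e => (rowBits e).map some ++ [none]) ++ none :: r =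
      φ'.flatMap (fun e => (rowBits e).map some ++ [none]) ++ none :: r' → φ = φ' ∧ r = r'
  | [], [], _, _, h => by simpa using h
  | [], e :: φ', r, r', h => by
    have h2 := @append_none_inj [] (rowBits e) r
      (φ'.flatMap (fun e => (rowBits e).map some ++ [none]) ++ none :: r') (by simpa using h)
    exact absurd h2.1.symm (rowBits_ne_nil e)
  | e :: φ, [], r, r', h => by
    have h2 := @append_none_inj (rowBits e) []
      (φ.flatMap (fun e => (rowBits e).map some ++ [none]) ++ none :: r) r' (by simpa using h)
    exact absurd h2.1 (rowBits_ne_nil e)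
  | e :: φ, e' :: φ', r, r', h => by
    simp only [List.flatMap_cons, List.append_assoc, List.singleton_append] at h
    obtain ⟨h1, h2⟩ := append_none_inj h
    obtain ⟨h3, h4⟩ := rows_inj h2
    exact ⟨by rw [rowBits_injective h1, h3], h4⟩

/-- Distinct instances have distinct encodings. -/
theorem encode_injective : Function.Injective encode := by
  rintro ⟨n, φ, d⟩ ⟨n', φ', d'⟩ h
  simp only [encode, ← List.map_replicate (f := some)] at h
  obtain ⟨h1, h2⟩ := append_none_inj h
  obtain rfl : n = n' := by simpa using congrArg List.length h1
  obtain ⟨rfl, h3⟩ := rows_inj h2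
  have h4 := List.map_injective_iff.2 (Option.some_injective _) h3
  rw [Computability.encodingNatBool.encode_injective h4]

end DifferInstance

/-- The instances `(φ, d)` in which `φ` is a 2-affine formula. -/
abbrev TwoAffineInstance := {I : DifferInstance // I.formula.IsKAffine 2}

/-- The decision problem `P`, with its instances written as strings by `enc`, is solvable in
polynomial time: some Turing machine decides it within a number of steps that is bounded by a
polynomial in the length of the input string. -/
def PolyTimeSolvable {α Γ : Type} (enc : α → List Γ) (P : α → Prop) : Prop :=
  ∃ f : α → Bool, (∀ a, f a = true ↔ P a) ∧
    Nonempty (Turing.TM2ComputableInPolyTime enc Computability.encodeBool f)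

/-! The difference of two solutions solves the homogeneous system, and conversely adding a
homogeneous solution to a solution gives a solution. So an instance asks two things: is the formula
satisfiable, and does the homogeneous system have a solution of Hamming weight exactly (or at least)
`d` (`differ_iff`, `reach_ofFn`)?

Attach to each variable its column of the matrix and a unary weight, initially 1. A homogeneous
equation with two variables forces them to be equal, so their columns are added and their weights
combined; an equation with one variable forces it to vanish, so its column is dropped. Both cases
are one elimination step `elim`: remove a pivot and add it to the remaining columns that meet the
equation. Since at most two columns meet the equation, the pivot is added to at most one other
column. Hence the bound two persists for later equations (`colCount_elim_le`), the total weight does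
not grow, and the weights of homogeneous solutions are preserved exactly (`reach_elim_none`).

After all eliminations the surviving columns are free, so the attainable weights are the subset sums
of a list of unary numbers, found by dynamic programming (`getD_table`). The right-hand side is
carried along as an extra last vector; it disappears exactly when an equation becomes inconsistent
(`exists_elim_rhs`, `exists_elims`).

For the time bound, the algorithm is written as a structured stack program that compiles to a
multi-stack Turing machine. Composable rules (`Runs.seq`, `Runs.case`, `Runs.loop_cons`) give its
effect and running time. All intermediate data have polynomial length (`length_strs_elims_le`), so
the total time is polynomial (`runs_main`). -/

/-- Structured programs over stacks indexed by `K` with symbols in `A`. `case` and `loop` pop a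
symbol from a stack and branch on it; `loop` ends when it meets an end symbol or an empty stack. -/
inductive StackProg (K A : Type) : Type
  | skip : StackProg K A
  | push : K → A → StackProg K A
  | seq : StackProg K A → StackProg K A → StackProg K A
  | case : K → (Option A → StackProg K A) → StackProg K A
  | loop : K → (A → Bool) → (A → StackProg K A) → StackProg K A

/-! ### Structured stack programs, their compilation and composable time bounds -/

namespace StackProg

open Turing StateTransition

variable {K A : Type}

/-- The labels of the machine code of a program. -/
def Pos : StackProg K A → Type
  | skip => Unit
  | push _ _ => Unit
  | seq p q => p.Pos ⊕ q.Pos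
  | case _ f => Option (Σ a, (f a).Pos)
  | loop _ _ f => Option (Σ a, (f a).Pos)

/-- The label at which a program starts. -/
def entry : (p : StackProg K A) → p.Pos
  | skip => ()
  | push _ _ => ()
  | seq p _ => Sum.inl p.entry
  | case _ _ => none
  | loop _ _ _ => none

noncomputable instance fintypePos [Fintype A] : (p : StackProg K A) → Fintype p.Pos
  | skip => inferInstanceAs (Fintype Unit)
  | push _ _ => inferInstanceAs (Fintype Unit)
  | seq p q =>
    letI := fintypePos p
    letI := fintypePos q
    inferInstanceAs (Fintype (p.Pos ⊕ q.Pos))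
  | case _ f =>
    letI := fun a => fintypePos (f a)
    inferInstanceAs (Fintype (Option (Σ a, (f a).Pos)))
  | loop _ _ f =>
    letI := fun a => fintypePos (f a)
    inferInstanceAs (Fintype (Option (Σ a, (f a).Pos)))

/-- The alphabets of the stacks of the machine; the stack `none` is the output stack. -/
abbrev Alph (K A : Type) : Option K → Type
  | none => Bool
  | some _ => A

/-- The machine code of a program whose labels are embedded by `emb` and which exits to `x`. -/
def code {Λ : Type} : (p : StackProg K A) → (p.Pos → Λ) → Λ → p.Pos →
    TM2.Stmt (Alph K A) Λ (Option A)
  | skip, _, x, _ => .goto fun _ => x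
  | push k a, _, x, _ => .push (some k) (fun _ => a) (.goto fun _ => x)
  | seq p q, emb, _, Sum.inl i => p.code (fun j => emb (Sum.inl j)) (emb (Sum.inr q.entry)) i
  | seq _ q, emb, x, Sum.inr i => q.code (fun j => emb (Sum.inr j)) x i
  | case k f, emb, _, none =>
    .pop (some k) (fun _ a => a) (.goto fun v => emb (some ⟨v, (f v).entry⟩))
  | case _ f, emb, x, some ⟨a, i⟩ => (f a).code (fun j => emb (some ⟨a, j⟩)) x i
  | loop k isEnd f, emb, x, none =>
    .pop (some k) (fun _ a => a) (.goto fun v =>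
      match v with
      | none => x
      | some a => if isEnd a then x else emb (some ⟨a, (f a).entry⟩))
  | loop _ _ f, emb, _, some ⟨a, i⟩ => (f a).code (fun j => emb (some ⟨a, j⟩)) (emb none) i

variable [DecidableEq K]

/-- The stacks of the machine, with an empty output stack. -/
def lift (S : K → List A) : (k : Option K) → List (Alph K A k)
  | none => []
  | some k => S k

theorem update_lift (S : K → List A) (k : K) (l : List A) :
    Function.update (lift S) (some k) l = lift (Function.update S k l) := by
  funext j
  rcases j with _ | j
  · rfl
  · by_cases h : j = k
    · subst h; simp [lift]
    · simp [lift, h]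

/-- Started on the stacks `S`, the program ends with the stacks `S'` after at most `t` steps. -/
def Runs (p : StackProg K A) (S S' : K → List A) (t : ℕ) : Prop :=
  ∀ (Λ : Type) (M : Λ → TM2.Stmt (Alph K A) Λ (Option A)) (emb : p.Pos → Λ) (x : Λ),
    (∀ i, M (emb i) = p.code emb x i) → ∀ v, ∃ v',
      Nonempty (EvalsToInTime (TM2.step M) ⟨some (emb p.entry), v, lift S⟩
        (some ⟨some x, v', lift S'⟩) t)

def evalsToInTimeOne {σ : Type} {f : σ → Option σ} {a b : σ} (h : f a = some b) :
    EvalsToInTime f a (some b) 1 :=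
  ⟨⟨1, by simpa [flip] using h⟩, le_rfl⟩

variable {S S₁ S₂ : K → List A} {t t₁ t₂ : ℕ} {k : K} {a : A} {l : List A}

theorem Runs.mono {p : StackProg K A} (h : Runs p S S₁ t₁) (ht : t₁ ≤ t) : Runs p S S₁ t := by
  intro Λ M emb x hM v
  obtain ⟨v', ⟨e⟩⟩ := h Λ M emb x hM v
  exact ⟨v', ⟨⟨e.toEvalsTo, e.steps_le_m.trans ht⟩⟩⟩

theorem Runs.congr {p : StackProg K A} {S' S₁' : K → List A} (h : Runs p S S₁ t₁) (hS : S = S')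
    (hS₁ : S₁ = S₁') (ht : t₁ ≤ t) : Runs p S' S₁' t :=
  hS ▸ hS₁ ▸ h.mono ht

theorem Runs.skip : Runs (skip : StackProg K A) S S 1 := by
  intro Λ M emb x hM v
  refine ⟨v, ⟨evalsToInTimeOne ?_⟩⟩
  simp [TM2.step, hM, code]

theorem Runs.push : Runs (push k a) S (Function.update S k (a :: S k)) 1 := by
  intro Λ M emb x hM v
  refine ⟨v, ⟨evalsToInTimeOne ?_⟩⟩
  simp only [TM2.step, hM, code, TM2.stepAux]
  rw [← update_lift]
  rfl

/-- `Runs` quantifies over the ambient machine, the embedding of labels and the exit label. So the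
code of `p` can be viewed inside the code of the composite, with the entry of `q` as its exit. -/
theorem Runs.seq {p q : StackProg K A} (h₁ : Runs p S S₁ t₁) (h₂ : Runs q S₁ S₂ t₂) :
    Runs (p.seq q) S S₂ (t₁ + t₂) := by
  intro Λ M emb x hM v
  obtain ⟨v₁, ⟨e₁⟩⟩ := h₁ Λ M (fun j => emb (Sum.inl j)) (emb (Sum.inr q.entry))
    (fun i => hM (Sum.inl i)) v
  obtain ⟨v₂, ⟨e₂⟩⟩ := h₂ Λ M (fun j => emb (Sum.inr j)) x (fun i => hM (Sum.inr i)) v₁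
  rw [add_comm]
  exact ⟨v₂, ⟨EvalsToInTime.trans _ _ _ _ _ _ e₁ e₂⟩⟩

theorem Runs.case {f : Option A → StackProg K A}
    (h : Runs (f (S k).head?) (Function.update S k (S k).tail) S₁ t) :
    Runs (case k f) S S₁ (1 + t) := by
  intro Λ M emb x hM v
  obtain ⟨v', ⟨e⟩⟩ := h Λ M (fun j => emb (some ⟨_, j⟩)) x (fun i => hM (some ⟨_, i⟩)) (S k).head?
  rw [add_comm]
  refine ⟨v', ⟨EvalsToInTime.trans _ _ _ _ _ _ (evalsToInTimeOne ?_) e⟩⟩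
  rw [← update_lift, TM2.step, hM]
  rfl

theorem Runs.loop_nil {isEnd : A → Bool} {f : A → StackProg K A} (hS : S k = []) :
    Runs (loop k isEnd f) S S 1 := by
  intro Λ M emb x hM v
  refine ⟨none, ⟨evalsToInTimeOne ?_⟩⟩
  have h : lift S (some k) = [] := hS
  have h' : Function.update (lift S) (some k) [] = lift S := by
    rw [← h, Function.update_eq_self]
  rw [TM2.step, hM, entry, code, TM2.stepAux, h]
  simp [h']

theorem Runs.loop_end {isEnd : A → Bool} {f : A → StackProg K A} (hS : S k = a :: l)
    (ha : isEnd a = true) : Runs (loop k isEnd f) S (Function.update S k l) 1 := by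
  intro Λ M emb x hM v
  refine ⟨some a, ⟨evalsToInTimeOne ?_⟩⟩
  have h : lift S (some k) = a :: l := hS
  rw [← update_lift, TM2.step, hM, entry, code, TM2.stepAux, h]
  simp [ha]

/-- Unrolls one iteration: the body is run with the loop's own entry as its exit label. Together
with the two rules for termination this lets loops be analysed by induction on the popped data. -/
theorem Runs.loop_cons {isEnd : A → Bool} {f : A → StackProg K A} (hS : S k = a :: l)
    (ha : isEnd a = false) (h₁ : Runs (f a) (Function.update S k l) S₁ t₁)
    (h₂ : Runs (loop k isEnd f) S₁ S₂ t₂) : Runs (loop k isEnd f) S S₂ (1 + t₁ + t₂) := by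
  intro Λ M emb x hM v
  obtain ⟨v₁, ⟨e₁⟩⟩ := h₁ Λ M (fun j => emb (some ⟨_, j⟩)) (emb (loop k isEnd f).entry)
    (fun i => hM (some ⟨_, i⟩))
    (some a)
  obtain ⟨v₂, ⟨e₂⟩⟩ := h₂ Λ M emb x hM v₁
  have e₀ : EvalsToInTime (TM2.step M) ⟨some (emb (loop k isEnd f).entry), v, lift S⟩
      (some ⟨some (emb (some ⟨a, (f a).entry⟩)), some a, lift (Function.update S k l)⟩) 1 := by
    refine evalsToInTimeOne ?_
    have h : lift S (some k) = a :: l := hS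
    rw [← update_lift, TM2.step, hM, entry, code, TM2.stepAux, h]
    simp [ha]
  rw [add_comm, add_comm 1]
  exact ⟨v₂, ⟨EvalsToInTime.trans _ _ _ _ _ _ (EvalsToInTime.trans _ _ _ _ _ _ e₀ e₁) e₂⟩⟩

/-- The machine that runs `p` on the input in stack `kin`, pops a symbol from the stack `kout`
and outputs its image under `ans`. -/
noncomputable def machine [Fintype K] [Fintype A] (p : StackProg K A) (kin kout : K)
    (ans : Option A → Bool) : FinTM2 where
  K := Option K
  k₀ := some kin
  k₁ := none
  Γ := Alph K A
  Λ := Option p.Pos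
  main := some p.entry
  σ := Option A
  initialState := none
  Γk₀Fin := inferInstanceAs (Fintype A)
  m
    | some i => p.code some none i
    | none => .pop (some kout) (fun _ a => a) (.push none ans (.load (fun _ => none) .halt))

/-- A halting configuration must have all stacks except the output empty and the internal state
reset. Hence `kout` may hold at most one symbol, which the single extra step consumes. -/
theorem machine_outputs [Fintype K] [Fintype A] (p : StackProg K A) (kin kout : K)
    (ans : Option A → Bool) (w l : List A)
    (h : Runs p (Function.update (fun _ => []) kin w) (Function.update (fun _ => []) kout l) t)
    (hl : l.tail = []) :
    Nonempty (TM2OutputsInTime (machine p kin kout ans) w (some [ans l.head?]) (t + 1)) := by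
  obtain ⟨v, ⟨e⟩⟩ := h (Option p.Pos) (machine p kin kout ans).m some none (fun _ => rfl) none
  rw [add_comm]
  have h₀ : initList (machine p kin kout ans) w =
      ⟨some (some p.entry), none, lift (Function.update (fun _ => []) kin w)⟩ := by
    unfold initList
    congr 1
    funext j
    rcases j with _ | j
    · rfl
    · by_cases hj : j = kin
      · subst hj
        simp [lift, machine]
        rfl
      · have : (some j : Option K) ≠ some kin := by simpa using hj
        simp [lift, machine, hj]
  have h₁ : haltList (machine p kin kout ans) [ans l.head?] =
      TM2.stepAux ((machine p kin kout ans).m none) v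
        (lift (Function.update (fun _ => []) kout l)) := by
    unfold haltList
    simp only [machine, TM2.stepAux]
    congr 1
    funext j
    rcases j with _ | j
    · simp [lift]
      rfl
    · have h₂ : ∀ (a : List Bool) (b : List A), b = [] → Function.update (Function.update
          (lift (Function.update (fun _ => ([] : List A)) kout l)) (some kout) b) none a
            (some j) = [] := by
        rintro a _ rfl
        by_cases hj : j = kout
        · subst hj
          simp
        · simp [lift, hj]
      exact (dif_neg (Option.some_ne_none j)).trans (h₂ _ _ (by simpa [lift] using hl)).symm
  refine ⟨?_⟩
  unfold TM2OutputsInTime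
  rw [h₀, Option.map_some, h₁]
  exact EvalsToInTime.trans _ _ _ _ _ _ e (evalsToInTimeOne rfl)

end StackProg

/-! ### The program: elimination on columns, subset-sum table, binary lookup -/

namespace DifferMachine

open StackProg

/-- The stacks of the program that decides the problems. -/
inductive Stk
  | inp | vec | out | piv | aux | tab
  deriving DecidableEq

instance : Fintype Stk :=
  ⟨{.inp, .vec, .out, .piv, .aux, .tab}, fun k => by cases k <;> simp⟩

/-- Symbols: the two bits and the separator `none`. -/
abbrev Sym := Option Bool

/-- The stacks with the given contents. -/
def st (i v o p q t : List Sym) : Stk → List Sym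
  | .inp => i
  | .vec => v
  | .out => o
  | .piv => p
  | .aux => q
  | .tab => t

section Stacks

variable (i v o p q t l : List Sym)

@[simp] theorem st_inp : st i v o p q t .inp = i := rfl
@[simp] theorem st_vec : st i v o p q t .vec = v := rfl
@[simp] theorem st_out : st i v o p q t .out = o := rfl
@[simp] theorem st_piv : st i v o p q t .piv = p := rfl
@[simp] theorem st_aux : st i v o p q t .aux = q := rfl
@[simp] theorem st_tab : st i v o p q t .tab = t := rfl

@[simp] theorem update_inp : Function.update (st i v o p q t) .inp l = st l v o p q t := by
  funext k; cases k <;> rfl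
@[simp] theorem update_vec : Function.update (st i v o p q t) .vec l = st i l o p q t := by
  funext k; cases k <;> rfl
@[simp] theorem update_out : Function.update (st i v o p q t) .out l = st i v l p q t := by
  funext k; cases k <;> rfl
@[simp] theorem update_piv : Function.update (st i v o p q t) .piv l = st i v o l q t := by
  funext k; cases k <;> rfl
@[simp] theorem update_aux : Function.update (st i v o p q t) .aux l = st i v o p l t := by
  funext k; cases k <;> rfl
@[simp] theorem update_tab : Function.update (st i v o p q t) .tab l = st i v o p q l := by
  funext k; cases k <;> rfl

end Stacks

section Prog

/-- No symbol is an end symbol. -/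
def never : Sym → Bool := fun _ => false

/-- Empties a stack. -/
def clear (k : Stk) : StackProg Stk Sym := loop k never fun _ => skip

/-- Moves the contents of a stack to another stack. -/
def moveAll (k k' : Stk) : StackProg Stk Sym := loop k never fun a => push k' a

/-- Moves the symbols before the next separator, which is removed. -/
def moveBits (k k' : Stk) : StackProg Stk Sym := loop k Option.isNone fun a => push k' a

/-- Moves the symbols up to and including the next separator. -/
def moveField (k k' : Stk) : StackProg Stk Sym := (moveBits k k').seq (push k' none)

/-- Moves a vector, which consists of two fields. -/
def moveVec (k' : Stk) : StackProg Stk Sym := (moveField .vec k').seq (moveField .vec k')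

/-- Writes the vectors without column bits. -/
def initVecs : StackProg Stk Sym :=
  (push .vec none).seq <| (push .vec (some false)).seq <| (push .vec none).seq <|
    loop .inp Option.isNone fun _ =>
      (push .vec none).seq <| (push .vec (some true)).seq (push .vec none)

/-- Puts a bit in front of the next vector. -/
def spread (b : Sym) : StackProg Stk Sym := (push .out b).seq (moveVec .out)

/-- Puts the bits of a row, whose first bit is `b`, in front of the vectors. -/
def readRow (b : Sym) : StackProg Stk Sym :=
  (spread b).seq <| (loop .inp Option.isNone spread).seq (moveAll .out .vec)

/-- Distributes the rows to the vectors. -/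
def readRows : StackProg Stk Sym := loop .inp Option.isNone readRow

/-- The sum of two bits. -/
def symXor : Sym → Sym → Sym
  | some a, some b => some (xor a b)
  | _, _ => none

/-- The disjunction of two bits. -/
def symOr : Sym → Sym → Sym
  | some a, some b => some (a || b)
  | _, _ => none

/-- Writes the sum of the column bits of the next vector and of the pivot. -/
def xorField : StackProg Stk Sym :=
  loop .vec Option.isNone fun a => case .piv fun
    | none => skip
    | some b => (push .out (symXor a b)).seq (push .aux b)

/-- Adds the pivot to the next vector. -/
def addPivot : StackProg Stk Sym :=
  xorField.seq <| (case .piv fun _ => skip).seq <| (push .aux none).seq <| (push .out none).seq <|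
    (moveBits .vec .out).seq <|
    (loop .piv never fun a => (push .out a).seq (push .aux a)).seq (moveAll .aux .piv)

/-- Makes the next vector the pivot. -/
def takePivot : StackProg Stk Sym := (moveVec .aux).seq (moveAll .aux .piv)

/-- Processes the next vector, whose first bit was `a`. -/
def elimVec : Sym → StackProg Stk Sym
  | some true => case .piv fun
    | none => takePivot
    | some b => (push .piv b).seq addPivot
  | _ => moveVec .out

/-- Eliminates with the first bits of the vectors. -/
def elimRow (a : Sym) : StackProg Stk Sym :=
  (elimVec a).seq <| (loop .vec never elimVec).seq <| (clear .piv).seq (moveAll .out .vec)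

/-- Eliminates until there are no column bits left. -/
def elimRows : StackProg Stk Sym := loop .vec Option.isNone elimRow

/-- Superposes the table and its old version. -/
def combine : StackProg Stk Sym :=
  (loop .tab never fun a => case .aux fun
    | none => push .out a
    | some b => push .out (symOr a b)).seq
  (loop .out never fun a => (push .tab a).seq (push .aux a))

/-- Processes a symbol of the weights. -/
def tableStep (c : Bool) : Sym → StackProg Stk Sym
  | none => combine
  | some true => push .tab (some c)
  | some false => (push .piv (some true)).seq (clear .vec)

/-- Computes the table of the sums of weights, and the flag that the formula is satisfiable. -/
def buildTable (c : Bool) : StackProg Stk Sym :=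
  (push .vec none).seq <| (push .tab (some true)).seq <| (push .aux (some true)).seq <|
    loop .vec never (tableStep c)

/-- Keeps every second entry of the table. -/
def decimate : StackProg Stk Sym :=
  (loop .tab never fun a => (push .out a).seq (case .tab fun _ => skip)).seq (moveAll .out .tab)

/-- Removes the first entry of the table if the bit is `1`. -/
def dropIf : Sym → StackProg Stk Sym
  | some true => case .tab fun _ => skip
  | _ => skip

/-- Moves the table entry whose index is the number in the input to the top. -/
def lookup : StackProg Stk Sym := loop .inp never fun b => (dropIf b).seq decimate

/-- Writes the answer and clears the stacks. -/
def finish : StackProg Stk Sym :=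
  (clear .aux).seq <| case .piv fun
    | none => clear .tab
    | some _ => case .tab fun
      | some (some true) => (clear .tab).seq (push .tab (some true))
      | _ => clear .tab

/-- The program. -/
def main (c : Bool) : StackProg Stk Sym :=
  initVecs.seq <| readRows.seq <| elimRows.seq <| (buildTable c).seq <| lookup.seq finish

end Prog

/-! ### The algorithm on lists, independent of the machine -/

section Model

/-- A vector: its column bits and its weight. -/
abbrev Vec := List Bool × List Bool

/-- The string of a vector. -/
def str (x : Vec) : List Sym := x.1.map some ++ none :: (x.2.map some ++ [none])

/-- The string of a list of vectors. -/
def strs (L : List Vec) : List Sym := L.flatMap str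

theorem length_str (x : Vec) : (str x).length = x.1.length + x.2.length + 2 := by
  simp [str]; omega

@[simp] theorem strs_nil : strs [] = [] := rfl

@[simp] theorem strs_cons (x : Vec) (L : List Vec) : strs (x :: L) = str x ++ strs L := rfl

@[simp] theorem strs_append (L L' : List Vec) : strs (L ++ L') = strs L ++ strs L' := by
  simp [strs]

theorem length_le_strs (L : List Vec) : 2 * L.length ≤ (strs L).length := by
  induction L with
  | nil => simp
  | cons x L ih => simp [length_str]; omega

/-- Puts the bits of a row in front of the vectors. -/
def addRow (bs : List Bool) (L : List Vec) : List Vec :=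
  List.zipWith (fun b x => (b :: x.1, x.2)) bs L

/-- Sum of the column bits and concatenation of the weights. -/
def addVec (x y : Vec) : Vec := (List.zipWith xor x.1 y.1, x.2 ++ y.2)

/-- One elimination: the first vector with first bit `1` becomes the pivot, which is added to the
other vectors with first bit `1`; the first bits are removed. -/
def elim : Option Vec → List Vec → List Vec
  | _, [] => []
  | q, ([], _) :: L => elim q L
  | q, (false :: c, w) :: L => (c, w) :: elim q L
  | none, (true :: c, w) :: L => elim (some (c, w)) L
  | some y, (true :: c, w) :: L => addVec (c, w) y :: elim (some y) L

/-- `k` eliminations. -/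
def elims : ℕ → List Vec → List Vec
  | 0, L => L
  | k + 1, L => elims k (elim none L)

/-- Entrywise disjunction, padded to the length of the first list. -/
def orPad : List Bool → List Bool → List Bool
  | [], _ => []
  | a :: l, [] => a :: l
  | a :: l, b :: l' => (a || b) :: orPad l l'

/-- The table after a list of weights. -/
def table (c : Bool) : List ℕ → List Bool → List Bool
  | [], T => T
  | w :: ws, T => table c ws (orPad (List.replicate w c ++ T) T)

/-- The entries with even indices. -/
def evens : List Bool → List Bool
  | [] => []
  | [a] => [a]
  | a :: _ :: l => a :: evens l

/-- The table after its entry whose index has the given bits is moved to the top. -/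
def pick : List Bool → List Bool → List Bool
  | [], T => T
  | b :: bs, T => pick bs (evens (bif b then T.tail else T))

end Model

/-! ### Running times: moving data and reading the matrix -/

section Runs

variable {i v o p q t : List Sym} {a : Sym}

theorem runs_push_vec : Runs (push .vec a) (st i v o p q t) (st i (a :: v) o p q t) 1 := by
  simpa using Runs.push (k := Stk.vec) (a := a) (S := st i v o p q t)
theorem runs_push_out : Runs (push .out a) (st i v o p q t) (st i v (a :: o) p q t) 1 := by
  simpa using Runs.push (k := Stk.out) (a := a) (S := st i v o p q t)
theorem runs_push_piv : Runs (push .piv a) (st i v o p q t) (st i v o (a :: p) q t) 1 := by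
  simpa using Runs.push (k := Stk.piv) (a := a) (S := st i v o p q t)
theorem runs_push_aux : Runs (push .aux a) (st i v o p q t) (st i v o p (a :: q) t) 1 := by
  simpa using Runs.push (k := Stk.aux) (a := a) (S := st i v o p q t)
theorem runs_push_tab : Runs (push .tab a) (st i v o p q t) (st i v o p q (a :: t)) 1 := by
  simpa using Runs.push (k := Stk.tab) (a := a) (S := st i v o p q t)

section Loops

variable {isEnd : Sym → Bool} {f : Sym → StackProg Stk Sym} {S S₁ : Stk → List Sym} {m n : ℕ}

theorem runs_inp_cons (ha : isEnd a = false) (h₁ : Runs (f a) (st i v o p q t) S₁ m)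
    (h₂ : Runs (loop .inp isEnd f) S₁ S n) :
    Runs (loop .inp isEnd f) (st (a :: i) v o p q t) S (1 + m + n) :=
  Runs.loop_cons rfl ha (by simpa using h₁) h₂

theorem runs_vec_cons (ha : isEnd a = false) (h₁ : Runs (f a) (st i v o p q t) S₁ m)
    (h₂ : Runs (loop .vec isEnd f) S₁ S n) :
    Runs (loop .vec isEnd f) (st i (a :: v) o p q t) S (1 + m + n) :=
  Runs.loop_cons rfl ha (by simpa using h₁) h₂

theorem runs_out_cons (ha : isEnd a = false) (h₁ : Runs (f a) (st i v o p q t) S₁ m)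
    (h₂ : Runs (loop .out isEnd f) S₁ S n) :
    Runs (loop .out isEnd f) (st i v (a :: o) p q t) S (1 + m + n) :=
  Runs.loop_cons rfl ha (by simpa using h₁) h₂

theorem runs_piv_cons (ha : isEnd a = false) (h₁ : Runs (f a) (st i v o p q t) S₁ m)
    (h₂ : Runs (loop .piv isEnd f) S₁ S n) :
    Runs (loop .piv isEnd f) (st i v o (a :: p) q t) S (1 + m + n) :=
  Runs.loop_cons rfl ha (by simpa using h₁) h₂

theorem runs_aux_cons (ha : isEnd a = false) (h₁ : Runs (f a) (st i v o p q t) S₁ m)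
    (h₂ : Runs (loop .aux isEnd f) S₁ S n) :
    Runs (loop .aux isEnd f) (st i v o p (a :: q) t) S (1 + m + n) :=
  Runs.loop_cons rfl ha (by simpa using h₁) h₂

theorem runs_tab_cons (ha : isEnd a = false) (h₁ : Runs (f a) (st i v o p q t) S₁ m)
    (h₂ : Runs (loop .tab isEnd f) S₁ S n) :
    Runs (loop .tab isEnd f) (st i v o p q (a :: t)) S (1 + m + n) :=
  Runs.loop_cons rfl ha (by simpa using h₁) h₂

theorem runs_inp_end (ha : isEnd a = true) :
    Runs (loop .inp isEnd f) (st (a :: i) v o p q t) (st i v o p q t) 1 := by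
  simpa using Runs.loop_end (S := st (a :: i) v o p q t) (k := Stk.inp) (f := f) (l := i) rfl ha

theorem runs_vec_end (ha : isEnd a = true) :
    Runs (loop .vec isEnd f) (st i (a :: v) o p q t) (st i v o p q t) 1 := by
  simpa using Runs.loop_end (S := st i (a :: v) o p q t) (k := Stk.vec) (f := f) (l := v) rfl ha

theorem runs_case_piv {f : Option Sym → StackProg Stk Sym}
    (h : Runs (f p.head?) (st i v o p.tail q t) S n) :
    Runs (case .piv f) (st i v o p q t) S (1 + n) :=
  Runs.case (by simpa using h)

theorem runs_case_aux {f : Option Sym → StackProg Stk Sym}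
    (h : Runs (f q.head?) (st i v o p q.tail t) S n) :
    Runs (case .aux f) (st i v o p q t) S (1 + n) :=
  Runs.case (by simpa using h)

theorem runs_case_tab {f : Option Sym → StackProg Stk Sym}
    (h : Runs (f t.head?) (st i v o p q t.tail) S n) :
    Runs (case .tab f) (st i v o p q t) S (1 + n) :=
  Runs.case (by simpa using h)

end Loops

theorem runs_clear_vec :
    Runs (clear .vec) (st i v o p q t) (st i [] o p q t) (2 * v.length + 1) := by
  induction v with
  | nil => exact Runs.loop_nil rfl
  | cons a v ih => exact (runs_vec_cons rfl Runs.skip ih).mono (by simp; omega)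

theorem runs_clear_piv :
    Runs (clear .piv) (st i v o p q t) (st i v o [] q t) (2 * p.length + 1) := by
  induction p with
  | nil => exact Runs.loop_nil rfl
  | cons a p ih => exact (runs_piv_cons rfl Runs.skip ih).mono (by simp; omega)

theorem runs_clear_aux :
    Runs (clear .aux) (st i v o p q t) (st i v o p [] t) (2 * q.length + 1) := by
  induction q with
  | nil => exact Runs.loop_nil rfl
  | cons a q ih => exact (runs_aux_cons rfl Runs.skip ih).mono (by simp; omega)

theorem runs_clear_tab :
    Runs (clear .tab) (st i v o p q t) (st i v o p q []) (2 * t.length + 1) := by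
  induction t with
  | nil => exact Runs.loop_nil rfl
  | cons a t ih => exact (runs_tab_cons rfl Runs.skip ih).mono (by simp; omega)

theorem runs_moveAll_out_vec : Runs (moveAll .out .vec) (st i v o p q t)
    (st i (o.reverse ++ v) [] p q t) (2 * o.length + 1) := by
  induction o generalizing v with
  | nil => exact Runs.loop_nil rfl
  | cons a o ih =>
    exact (runs_out_cons rfl runs_push_vec ih).congr rfl (by simp) (by simp; omega)

theorem runs_moveAll_aux_piv : Runs (moveAll .aux .piv) (st i v o p q t)
    (st i v o (q.reverse ++ p) [] t) (2 * q.length + 1) := by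
  induction q generalizing p with
  | nil => exact Runs.loop_nil rfl
  | cons a q ih =>
    exact (runs_aux_cons rfl runs_push_piv ih).congr rfl (by simp) (by simp; omega)

theorem runs_moveAll_out_tab : Runs (moveAll .out .tab) (st i v o p q t)
    (st i v [] p q (o.reverse ++ t)) (2 * o.length + 1) := by
  induction o generalizing t with
  | nil => exact Runs.loop_nil rfl
  | cons a o ih =>
    exact (runs_out_cons rfl runs_push_tab ih).congr rfl (by simp) (by simp; omega)

theorem runs_moveBits_out (l : List Bool) :
    Runs (moveBits .vec .out) (st i (l.map some ++ none :: v) o p q t)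
      (st i v ((l.map some).reverse ++ o) p q t) (2 * l.length + 1) := by
  induction l generalizing o with
  | nil => exact runs_vec_end rfl
  | cons a l ih =>
    exact (runs_vec_cons rfl runs_push_out ih).congr rfl (by simp) (by simp; omega)

theorem runs_moveBits_aux (l : List Bool) :
    Runs (moveBits .vec .aux) (st i (l.map some ++ none :: v) o p q t)
      (st i v o p ((l.map some).reverse ++ q) t) (2 * l.length + 1) := by
  induction l generalizing q with
  | nil => exact runs_vec_end rfl
  | cons a l ih =>
    exact (runs_vec_cons rfl runs_push_aux ih).congr rfl (by simp) (by simp; omega)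

theorem str_append (x : Vec) :
    str x ++ v = x.1.map some ++ none :: (x.2.map some ++ none :: v) := by
  simp [str]

theorem runs_moveVec_out (x : Vec) : Runs (moveVec .out) (st i (str x ++ v) o p q t)
    (st i v ((str x).reverse ++ o) p q t) (2 * (str x).length) := by
  rw [str_append]
  exact Runs.congr (((runs_moveBits_out x.1).seq runs_push_out).seq
    ((runs_moveBits_out x.2).seq runs_push_out)) rfl (by simp [str])
    (by simp [length_str]; omega)

theorem runs_moveVec_aux (x : Vec) : Runs (moveVec .aux) (st i (str x ++ v) o p q t)
    (st i v o p ((str x).reverse ++ q) t) (2 * (str x).length) := by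
  rw [str_append]
  exact Runs.congr (((runs_moveBits_aux x.1).seq runs_push_aux).seq
    ((runs_moveBits_aux x.2).seq runs_push_aux)) rfl (by simp [str])
    (by simp [length_str]; omega)

theorem runs_initVecs (n : ℕ) :
    Runs initVecs (st (List.replicate n (some true) ++ none :: i) [] o p q t)
      (st i (strs (List.replicate n ([], [true]) ++ [([], [false])])) o p q t) (4 * n + 4) := by
  have h : ∀ n v, Runs (loop .inp Option.isNone fun _ =>
      (push .vec none).seq <| (push .vec (some true)).seq (push .vec none))
      (st (List.replicate n (some true) ++ none :: i) v o p q t)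
      (st i (strs (List.replicate n ([], [true])) ++ v) o p q t) (4 * n + 1) := by
    intro n
    induction n with
    | zero => exact fun v => runs_inp_end rfl
    | succ n ih =>
      intro v
      have := runs_inp_cons (isEnd := Option.isNone) (a := some true) (f := fun _ =>
        (push .vec none).seq <| (push .vec (some true)).seq (push .vec none)) rfl
        (runs_push_vec.seq (runs_push_vec.seq runs_push_vec))
        (ih (none :: some true :: none :: v))
      exact this.congr (by simp [List.replicate_succ])
        (by rw [List.replicate_succ']; simp [str]) (by omega)
  exact Runs.congr (runs_push_vec.seq (runs_push_vec.seq (runs_push_vec.seq (h n _))))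
    rfl (by simp [str]) (by omega)

theorem runs_spread (x : Vec) (b : Bool) : Runs (spread (some b)) (st i (str x ++ v) o p q t)
    (st i v ((str (b :: x.1, x.2)).reverse ++ o) p q t) (2 * (str x).length + 1) := by
  exact Runs.congr (runs_push_out.seq (runs_moveVec_out x)) rfl (by simp [str]) (by omega)

theorem length_strs_addRow : ∀ {bs : List Bool} {L : List Vec}, bs.length = L.length →
    (strs (addRow bs L)).length = (strs L).length + bs.length
  | [], [], _ => rfl
  | b :: bs, x :: L, h => by
    have := length_strs_addRow (bs := bs) (L := L) (by simpa using h)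
    simp only [addRow] at this
    simp [addRow, length_str, this]; omega

theorem length_addRow {bs : List Bool} {L : List Vec} (h : bs.length = L.length) :
    (addRow bs L).length = L.length := by
  simp [addRow, h]

theorem runs_spreadLoop : ∀ {bs : List Bool} {L : List Vec}, bs.length = L.length → ∀ {o},
    Runs (loop .inp Option.isNone spread) (st (bs.map some ++ none :: i) (strs L) o p q t)
      (st i [] ((strs (addRow bs L)).reverse ++ o) p q t)
      (2 * (strs L).length + 2 * bs.length + 1)
  | [], [], _, _ => (runs_inp_end rfl).mono (by simp)
  | b :: bs, x :: L, h, _ => by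
    exact (runs_inp_cons rfl (runs_spread x b) (runs_spreadLoop (bs := bs) (L := L)
      (by simpa using h))).congr rfl (by simp [addRow]) (by simp; omega)

theorem runs_readRow {b : Bool} {bs : List Bool} {L : List Vec} (h : (b :: bs).length = L.length) :
    Runs (readRow (some b)) (st (bs.map some ++ none :: i) (strs L) [] p q t)
      (st i (strs (addRow (b :: bs) L)) [] p q t)
      (4 * (strs L).length + 4 * (bs.length + 1) + 2) := by
  obtain _ | ⟨x, L⟩ := L
  · simp at h
  have h' : bs.length = L.length := by simpa using h
  have h₂ := length_strs_addRow h'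
  exact Runs.congr ((runs_spread x b).seq ((runs_spreadLoop h').seq runs_moveAll_out_vec)) rfl
    (by simp [addRow, str]) (by simp [h₂, length_str]; omega)

/-- A row is never empty, as it contains the bit of the right-hand side; a separator where a row
should start therefore ends the matrix. Each row lengthens the vectors by `L.length` symbols in all,
so the quantity bounded by `B` is invariant. -/
theorem runs_readRows {B : ℕ} : ∀ {rows : List (List Bool)} {L : List Vec},
    (∀ bs ∈ rows, bs.length = L.length) → 0 < L.length →
    (strs L).length + rows.length * L.length ≤ B →
    Runs readRows
      (st (rows.flatMap (fun bs => bs.map some ++ [none]) ++ none :: i) (strs L) [] p q t)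
      (st i (strs (rows.foldl (fun L bs => addRow bs L) L)) [] p q t)
      (rows.length * (8 * B + 3) + 1)
  | [], _, _, _, _ => (runs_inp_end rfl).mono (by simp)
  | [] :: rows, L, h, hL, _ => by
    have := h [] (by simp)
    simp at this; omega
  | (b :: bs) :: rows, L, h, hL, hB => by
    have hb := h (b :: bs) (by simp)
    have hl := length_addRow hb
    have hs := length_strs_addRow hb
    simp only [List.length_cons, add_mul, one_mul] at hB
    have ih := runs_readRows (B := B) (rows := rows)
      (L := addRow (b :: bs) L)
      (fun bs' h' => by rw [hl]; exact h bs' (by simp [h'])) (by omega) (by rw [hs, hl]; omega)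
    have hlen : bs.length + 1 = L.length := by simpa using hb
    exact Runs.congr (runs_inp_cons rfl (runs_readRow hb) ih) (by simp) (by simp)
      (by simp only [List.length_cons, add_mul]; omega)

end Runs

/-! ### Running times: elimination -/

section Runs

variable {i v o p q t : List Sym} {a : Sym}

theorem runs_xorField : ∀ {c c' : List Bool}, c.length = c'.length → ∀ {o p q : List Sym},
    Runs xorField (st i (c.map some ++ none :: v) o (c'.map some ++ p) q t)
      (st i v (((List.zipWith xor c c').map some).reverse ++ o) p
        ((c'.map some).reverse ++ q) t) (4 * c.length + 1)
  | [], [], _, _, _, _ => runs_vec_end rfl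
  | a :: c, b :: c', h, o, p, q =>
    have h₁ : Runs (case .piv fun
        | none => skip
        | some b => (push .out (symXor (some a) b)).seq (push .aux b))
        (st i (c.map some ++ none :: v) o (some b :: (c'.map some ++ p)) q t)
        (st i (c.map some ++ none :: v) (some (xor a b) :: o) (c'.map some ++ p) (some b :: q) t)
        (1 + (1 + 1)) :=
      runs_case_piv (by exact runs_push_out.seq runs_push_aux)
    Runs.congr (runs_vec_cons rfl h₁ (runs_xorField (c := c) (c' := c') (by simpa using h))) rfl
      (by simp) (by simp; omega)

/-- The pivot is copied to `.aux` while it is being added and then moved back, so it remains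
available for later vectors. -/
theorem runs_addPivot {x y : Vec} (h : x.1.length = y.1.length) :
    Runs addPivot (st i (str x ++ v) o (str y) [] t)
      (st i v ((str (addVec x y)).reverse ++ o) (str y) [] t)
      (4 * (str x).length + 5 * (str y).length) := by
  have hloop : ∀ p o q, Runs (loop .piv never fun a => (push .out a).seq (push .aux a))
      (st i v o p q t) (st i v (p.reverse ++ o) [] (p.reverse ++ q) t) (3 * p.length + 1) := by
    intro p
    induction p with
    | nil => exact fun o q => Runs.loop_nil rfl
    | cons a p ih =>
      exact fun o q => Runs.congr (runs_piv_cons rfl (runs_push_out.seq runs_push_aux) (ih _ _))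
        rfl (by simp) (by simp; omega)
  rw [str_append, str]
  exact Runs.congr ((runs_xorField h).seq ((runs_case_piv Runs.skip).seq (runs_push_aux.seq
    (runs_push_out.seq ((runs_moveBits_out _).seq ((hloop _ _ _).seq runs_moveAll_aux_piv))))))
    rfl (by simp [str, addVec]) (by simp [length_str]; omega)

theorem runs_takePivot {x : Vec} :
    Runs takePivot (st i (str x ++ v) o [] [] t) (st i v o (str x) [] t)
      (4 * (str x).length + 1) :=
  Runs.congr ((runs_moveVec_aux x).seq runs_moveAll_aux_piv) rfl (by simp) (by simp; omega)

theorem runs_elimVec_take {x : Vec} :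
    Runs (elimVec (some true)) (st i (str x ++ v) o [] [] t) (st i v o (str x) [] t)
      (1 + (4 * (str x).length + 1)) :=
  runs_case_piv (by exact runs_takePivot)

/-- The string of the pivot. -/
def strOpt (y : Option Vec) : List Sym := y.elim [] str

/-- The final pivot is only bounded in length, because it is cleared afterwards. The factor `9 * B`
is the `4 * B + 5 * B` of adding a pivot, the most expensive case. -/
theorem runs_elimVecs {B k : ℕ} : ∀ {L : List Vec} {y : Option Vec},
    (∀ x ∈ L, x.1.length = k + 1) → (∀ x ∈ y, x.1.length = k) →
    (∀ x ∈ L, (str x).length ≤ B) → (strOpt y).length ≤ B → ∀ {o},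
    ∃ p, p.length ≤ B ∧
      Runs (loop .vec never elimVec) (st i (strs L) o (strOpt y) [] t)
        (st i [] ((strs (elim y L)).reverse ++ o) p [] t) (L.length * (9 * B + 3) + 1)
  | [], y, _, _, _, hy, o => ⟨_, hy, (Runs.loop_nil rfl).congr rfl (by simp [elim]) (by simp)⟩
  | ([], w) :: L, y, hL, _, _, _, _ => by simpa using hL ([], w) (by simp)
  | (false :: c, w) :: L, y, hL, hyl, hB, hy, o => by
    obtain ⟨p, hp, h⟩ := runs_elimVecs (B := B) (L := L) (y := y)
      (fun x hx => hL x (by simp [hx])) hyl (fun x hx => hB x (by simp [hx])) hy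
      (o := (str (c, w)).reverse ++ o)
    have hx := hB (false :: c, w) (by simp)
    refine ⟨p, hp, Runs.congr (runs_vec_cons (a := some false) rfl (runs_moveVec_out (c, w)) h)
      rfl (by simp [elim]) ?_⟩
    simp only [length_str, List.length_cons, add_mul] at hx ⊢
    omega
  | (true :: c, w) :: L, none, hL, hyl, hB, hy, o => by
    have hx := hB (true :: c, w) (by simp)
    simp only [length_str, List.length_cons] at hx
    obtain ⟨p, hp, h⟩ := runs_elimVecs (B := B) (k := k) (L := L) (y := some (c, w))
      (fun x hx => hL x (by simp [hx])) (by simpa using hL (true :: c, w) (by simp))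
      (fun x hx => hB x (by simp [hx])) (by simp [strOpt, length_str]; omega) (o := o)
    refine ⟨p, hp, Runs.congr (runs_vec_cons (a := some true) rfl runs_elimVec_take h)
      rfl (by simp [elim]) ?_⟩
    simp only [length_str, List.length_cons, add_mul]
    omega
  | (true :: c, w) :: L, some y, hL, hyl, hB, hy, o => by
    have hx := hB (true :: c, w) (by simp)
    simp only [length_str, List.length_cons] at hx
    obtain ⟨p, hp, h⟩ := runs_elimVecs (B := B) (L := L) (y := some y)
      (fun x hx => hL x (by simp [hx])) hyl (fun x hx => hB x (by simp [hx])) hy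
      (o := (str (addVec (c, w) y)).reverse ++ o)
    have hc : (c, w).1.length = y.1.length := by
      have h₁ := hL (true :: c, w) (by simp)
      have h₂ := hyl y rfl
      simp at h₁ h₂ ⊢
      omega
    -- The program tests whether there is a pivot by popping a symbol and pushing it back. The
    -- string of a vector is never empty, so the test is faithful.
    obtain ⟨a, l, hal⟩ : ∃ a l, str y = a :: l := by
      cases hs : str y with
      | nil => simp [str] at hs
      | cons a l => exact ⟨a, l, rfl⟩
    have h₁ : Runs (elimVec (some true)) (st i (str (c, w) ++ strs L) o (str y) [] t)
        (st i (strs L) ((str (addVec (c, w) y)).reverse ++ o) (str y) [] t)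
        (1 + (1 + (4 * (str (c, w)).length + 5 * (str y).length))) := by
      refine runs_case_piv ?_
      have h₂ := runs_addPivot (i := i) (v := strs L) (o := o) (t := t) hc
      rw [hal] at h₂ ⊢
      exact runs_push_piv.seq h₂
    refine ⟨p, hp, Runs.congr (runs_vec_cons (a := some true) rfl h₁ h) rfl (by simp [elim]) ?_⟩
    simp only [strOpt, Option.elim_some] at hy
    simp only [length_str, List.length_cons, add_mul] at hy ⊢
    omega

theorem length_elim_le : ∀ (y : Option Vec) (L : List Vec), (elim y L).length ≤ L.length
  | _, [] => by simp [elim]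
  | q, ([], _) :: L => by simpa [elim] using (length_elim_le q L).trans (Nat.le_succ _)
  | q, (false :: c, w) :: L => by simpa [elim] using length_elim_le q L
  | none, (true :: c, w) :: L => by
    simpa [elim] using (length_elim_le (some (c, w)) L).trans (Nat.le_succ _)
  | some y, (true :: c, w) :: L => by simpa [elim] using length_elim_le (some y) L

theorem length_elim_fst {k : ℕ} : ∀ {y : Option Vec} {L : List Vec},
    (∀ x ∈ L, x.1.length = k + 1) → (∀ x ∈ y, x.1.length = k) → ∀ x ∈ elim y L, x.1.length = k
  | _, [], _, _ => by simp [elim]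
  | q, ([], w) :: L, h, _ => by simpa using h ([], w) (by simp)
  | q, (false :: c, w) :: L, h, hq => by
    have := length_elim_fst (L := L) (fun x hx => h x (by simp [hx])) hq
    have := h (false :: c, w) (by simp)
    simp [elim] at *
    exact ⟨by omega, by assumption⟩
  | none, (true :: c, w) :: L, h, _ => by
    exact length_elim_fst (L := L) (fun x hx => h x (by simp [hx]))
      (by simpa using h (true :: c, w) (by simp))
  | some y, (true :: c, w) :: L, h, hq => by
    have := length_elim_fst (L := L) (fun x hx => h x (by simp [hx])) hq
    have := h (true :: c, w) (by simp)
    simp [elim, addVec] at *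
    exact ⟨by omega, by assumption⟩

theorem length_str_le_strs {x : Vec} {L : List Vec} (h : x ∈ L) :
    (str x).length ≤ (strs L).length := by
  induction L with
  | nil => simp at h
  | cons y L ih =>
    rcases List.mem_cons.1 h with rfl | h
    · simp
    · simpa using (ih h).trans (Nat.le_add_left _ _)

theorem runs_elimRow {B k : ℕ} {a : Bool} {c w : List Bool} {L : List Vec}
    (hL : ∀ x ∈ (a :: c, w) :: L, x.1.length = k + 1)
    (hB : (strs ((a :: c, w) :: L)).length ≤ B)
    (hB' : (strs (elim none ((a :: c, w) :: L))).length ≤ B) :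
    Runs (elimRow (some a)) (st i (str (c, w) ++ strs L) [] [] [] t)
      (st i (strs (elim none ((a :: c, w) :: L))) [] [] [] t)
      (B * (9 * B + 3) + 4 * B + 3) := by
  have hlen := length_le_strs ((a :: c, w) :: L)
  -- Each vector occupies at least two symbols, its separators, so there are at most `B` vectors.
  have hmul : (L.length + 1) * (9 * B + 3) ≤ B * (9 * B + 3) :=
    Nat.mul_le_mul_right _ (by simp only [List.length_cons] at hlen; omega)
  rw [add_mul] at hmul
  have hx : ∀ x ∈ (a :: c, w) :: L, (str x).length ≤ B :=
    fun x h => (length_str_le_strs h).trans hB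
  have hxc := hx (a :: c, w) (by simp)
  simp only [length_str, List.length_cons] at hxc
  cases a with
  | false =>
    obtain ⟨p, hp, h⟩ := runs_elimVecs (i := i) (t := t) (B := B) (k := k) (y := none) (L := L)
      (fun x h => hL x (by simp [h])) (by simp) (fun x h => hx x (by simp [h])) (by simp [strOpt])
      (o := (str (c, w)).reverse)
    refine Runs.congr ((runs_moveVec_out (c, w)).seq
      (Runs.seq (h.congr (by simp [strOpt]) rfl le_rfl)
      (runs_clear_piv.seq runs_moveAll_out_vec))) rfl (by simp [elim]) ?_
    simp only [elim, strs_cons, List.length_append, List.length_reverse, length_str] at hB' ⊢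
    omega
  | true =>
    obtain ⟨p, hp, h⟩ := runs_elimVecs (i := i) (t := t) (B := B) (k := k) (y := some (c, w))
      (L := L) (fun x h => hL x (by simp [h])) (by simpa using hL (true :: c, w) (by simp))
      (fun x h => hx x (by simp [h])) (by simp [strOpt, length_str]; omega)
      (o := [])
    refine Runs.congr (Runs.seq runs_elimVec_take (h.seq
      (runs_clear_piv.seq runs_moveAll_out_vec))) rfl (by simp [elim]) ?_
    simp only [elim, List.length_append, List.length_reverse, length_str, List.length_nil] at hB' ⊢
    omega

/-- The loop pops the first bit of the first vector. When no column bits are left it pops that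
vector's separator instead and stops, which accounts for the `tail`. -/
theorem runs_elimRows {B : ℕ} : ∀ {k : ℕ} {L : List Vec}, (∀ x ∈ L, x.1.length = k) →
    (∀ j ≤ k, (strs (elims j L)).length ≤ B) →
    Runs elimRows (st i (strs L) [] [] [] t) (st i (strs (elims k L)).tail [] [] [] t)
      (k * (B * (9 * B + 3) + 4 * B + 4) + 1)
  | k, [], _, _ => by
    have h : ∀ k, elims k [] = [] := by
      intro k
      induction k with
      | zero => rfl
      | succ k ih => simpa [elims, elim] using ih
    rw [h]
    exact (Runs.loop_nil rfl).mono (by omega)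
  | 0, ([], w) :: L, _, _ => (runs_vec_end (a := none) rfl).mono (by omega)
  | 0, (a :: c, w) :: L, h, _ => by simpa using h (a :: c, w) (by simp)
  | k + 1, ([], w) :: L, h, _ => by simpa using h ([], w) (by simp)
  | k + 1, (a :: c, w) :: L, h, hB => by
    have h₁ := runs_elimRow (i := i) (t := t) h (hB 0 (by omega)) (hB 1 (by omega))
    have h₂ := runs_elimRows (B := B) (k := k)
      (length_elim_fst h (by simp)) (fun j hj => hB (j + 1) (by omega))
    refine Runs.congr (runs_vec_cons (a := some a) rfl h₁ h₂) (by simp [str]) rfl ?_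
    rw [add_mul]; omega

end Runs

/-! ### Running times: table, lookup and answer -/

section Runs

variable {i v o p q t : List Sym} {a : Sym}

theorem length_orPad : ∀ T U : List Bool, (orPad T U).length = T.length
  | [], _ => rfl
  | _ :: _, [] => rfl
  | _ :: l, _ :: l' => by simp [orPad, length_orPad l l']

/-- Makes the first separator of a weight vector harmless: combining the table with an identical
copy changes nothing. -/
theorem orPad_self : ∀ T : List Bool, orPad T T = T
  | [] => rfl
  | _ :: l => by simp [orPad, orPad_self l]

theorem orPad_nil (T : List Bool) : orPad T [] = T := by
  cases T <;> rfl

theorem runs_combine {T U : List Bool} (h : U.length ≤ T.length) :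
    Runs combine (st i v [] p (U.map some) (T.map some))
      (st i v [] p ((orPad T U).map some) ((orPad T U).map some)) (6 * T.length + 2) := by
  have h₁ : ∀ (T U : List Bool) (o : List Sym), U.length ≤ T.length →
      Runs (loop .tab never fun a => case .aux fun
        | none => push .out a
        | some b => push .out (symOr a b)) (st i v o p (U.map some) (T.map some))
        (st i v (((orPad T U).map some).reverse ++ o) p [] []) (3 * T.length + 1) := by
    intro T
    induction T with
    | nil =>
      intro U o hU
      obtain rfl : U = [] := by simpa using hU
      exact Runs.loop_nil rfl
    | cons a T ih =>
      intro U o hU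
      cases U with
      | nil =>
        exact Runs.congr (runs_tab_cons (a := some a) rfl (runs_case_aux (q := [])
          (by exact runs_push_out)) (ih [] _ (by simp))) rfl (by simp [orPad, orPad_nil])
          (by simp; omega)
      | cons b U =>
        exact Runs.congr (runs_tab_cons (a := some a) rfl (runs_case_aux (q := some b :: U.map some)
          (by exact runs_push_out)) (ih U _ (by simpa using hU))) rfl (by simp [orPad, symOr])
          (by simp; omega)
  have h₂ : ∀ o q t : List Sym, Runs (loop .out never fun a => (push .tab a).seq (push .aux a))
      (st i v o p q t) (st i v [] p (o.reverse ++ q) (o.reverse ++ t)) (3 * o.length + 1) := by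
    intro o
    induction o with
    | nil => exact fun q t => Runs.loop_nil rfl
    | cons a o ih =>
      exact fun q t => Runs.congr (runs_out_cons rfl (runs_push_tab.seq runs_push_aux) (ih _ _))
        rfl (by simp) (by simp; omega)
  exact Runs.congr ((h₁ T U [] h).seq (h₂ _ _ _)) rfl (by simp)
    (by simp [length_orPad]; omega)

theorem runs_tableLoop_ones {c : Bool} {S : Stk → List Sym} {n w : ℕ} {T : List Bool}
    (h : Runs (loop .vec never (tableStep c))
      (st i v o p q ((List.replicate w c ++ T).map some)) S n) :
    Runs (loop .vec never (tableStep c))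
      (st i ((List.replicate w true).map some ++ v) o p q (T.map some)) S (2 * w + n) := by
  induction w generalizing T with
  | zero => simpa using h
  | succ w ih =>
    have h₁ := ih (T := c :: T) (by simpa [List.replicate_succ'] using h)
    exact Runs.congr (runs_vec_cons (a := some true) rfl (by exact runs_push_tab) h₁)
      (by simp [List.replicate_succ]) rfl (by omega)

theorem runs_tableLoop_combine {c : Bool} {S : Stk → List Sym} {n : ℕ} {T U : List Bool}
    (hU : U.length ≤ T.length)
    (h : Runs (loop .vec never (tableStep c))
      (st i v [] p ((orPad T U).map some) ((orPad T U).map some)) S n) :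
    Runs (loop .vec never (tableStep c))
      (st i (none :: v) [] p (U.map some) (T.map some)) S (6 * T.length + 3 + n) :=
  (runs_vec_cons (a := none) rfl (by exact runs_combine hU) h).mono (by omega)

theorem length_table (c : Bool) (ws : List ℕ) (T : List Bool) :
    (table c ws T).length = ws.sum + T.length := by
  induction ws generalizing T with
  | nil => simp [table]
  | cons w ws ih => simp [table, ih, length_orPad]; omega

/-- The vector without column bits and with weight `w`. -/
def ones (w : ℕ) : Vec := ([], List.replicate w true)

theorem sum_add_length_ones (ws : List ℕ) :
    ws.sum + 2 * ws.length = (strs (ws.map ones)).length := by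
  induction ws with
  | nil => rfl
  | cons w ws ih => simp [length_str, ones] at ih ⊢; omega

/-- A vector reads `# 1…1 #`. The first separator combines two equal tables, the ones shift the
table, and the second separator superposes the shifted and the old table. The `14 * B` is two
combinations of `6 * B` each and `2 * B` for the ones. -/
theorem runs_tableLoop {c : Bool} {S : Stk → List Sym} {n B : ℕ} : ∀ {ws : List ℕ} {T : List Bool},
    ws.sum + T.length ≤ B →
    Runs (loop .vec never (tableStep c))
      (st i v [] p ((table c ws T).map some) ((table c ws T).map some)) S n →
    Runs (loop .vec never (tableStep c))
      (st i (strs (ws.map ones) ++ v) [] p (T.map some) (T.map some)) S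
      (ws.length * (14 * B + 6) + n)
  | [], T, _, h => by simpa [table] using h
  | w :: ws, T, hB, h => by
    simp only [List.sum_cons] at hB
    have h₁ := runs_tableLoop (B := B) (ws := ws)
      (T := orPad (List.replicate w c ++ T) T) (by simp [length_orPad]; omega) h
    have h₂ := runs_tableLoop_combine (U := T) (T := List.replicate w c ++ T) (by simp) h₁
    have h₃ := runs_tableLoop_combine le_rfl
      (by rw [orPad_self]; exact runs_tableLoop_ones h₂)
    refine h₃.congr (by simp [str, ones]) rfl ?_
    simp only [List.length_append, List.length_replicate, List.length_cons, add_mul]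
    omega

theorem runs_buildTable {c : Bool} {ws : List ℕ} {P : Option (List Bool)} {B : ℕ}
    (hB : (strs (ws.map ones ++ (P.map fun w => ([], false :: w)).toList)).length ≤ B) :
    Runs (buildTable c)
      (st i (strs (ws.map ones ++ (P.map fun w => ([], false :: w)).toList)).tail [] [] [] [])
      (st i [] [] (P.map fun _ => some true).toList ((table c ws [true]).map some)
        ((table c ws [true]).map some)) (B * (14 * B + 20) + 30 * B + 30) := by
  have hs := sum_add_length_ones ws
  simp only [strs_append, List.length_append] at hB
  have hmul : ws.length * (14 * (B + 1) + 6) ≤ B * (14 * B + 20) := by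
    rw [show 14 * (B + 1) + 6 = 14 * B + 20 by ring]
    exact Nat.mul_le_mul_right _ (by omega)
  have hlen := length_table c ws [true]
  simp only [List.length_singleton] at hlen
  -- If no vector is left, the separator pushed at the start was never consumed before; it only
  -- triggers one idempotent combination.
  by_cases hnil : ws.map ones ++ (P.map fun w => (([], false :: w) : Vec)).toList = []
  · obtain ⟨h₁, h₂⟩ := List.append_eq_nil_iff.1 hnil
    have h₁ : ws = [] := by simpa using h₁
    have h₂ : P = none := by cases P <;> simp_all
    subst h₁ h₂
    have := runs_tableLoop_combine (c := c) (i := i) (v := []) (p := []) (T := [true])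
      (U := [true]) le_rfl (Runs.loop_nil rfl)
    exact Runs.congr (runs_push_vec.seq (runs_push_tab.seq (runs_push_aux.seq this))) rfl
      (by simp [table, orPad]) (by simp)
  -- Otherwise the pushed separator restores the one consumed when the elimination loop ended.
  have hcons : none :: (strs (ws.map ones ++ (P.map fun w => (([], false :: w) : Vec)).toList)).tail
      = strs (ws.map ones ++ (P.map fun w => (([], false :: w) : Vec)).toList) := by
    cases ws with
    | nil =>
      cases P with
      | none => simp at hnil
      | some w => simp [str]
    | cons w ws => simp [str, ones]
  -- The leading `false` in the weight of a surviving right-hand side tells it apart from the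
  -- columns: it sets the satisfiability flag and discards the rest of the input, which is sound
  -- because this vector is last.
  have hend : Runs (loop .vec never (tableStep c))
      (st i (strs (P.map fun w => (([], false :: w) : Vec)).toList) [] []
        ((table c ws [true]).map some) ((table c ws [true]).map some))
      (st i [] [] (P.map fun _ => some true).toList ((table c ws [true]).map some)
        ((table c ws [true]).map some)) (8 * B + 20) := by
    cases P with
    | none => exact (Runs.loop_nil rfl).mono (by omega)
    | some w =>
      have h₁ : Runs (loop .vec never (tableStep c))
          (st i (some false :: (w.map some ++ [none])) [] []
          ((table c ws [true]).map some) ((table c ws [true]).map some))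
          (st i [] [] [some true] ((table c ws [true]).map some) ((table c ws [true]).map some))
          (1 + (1 + (2 * (w.map some ++ [none] : List Sym).length + 1)) + 1) :=
        runs_vec_cons rfl (by exact runs_push_piv.seq runs_clear_vec) (Runs.loop_nil rfl)
      refine (runs_tableLoop_combine le_rfl (by rw [orPad_self]; exact h₁)).congr
        (by simp [str]) (by simp) ?_
      simp [length_str] at hB ⊢
      omega
  -- The extra one accounts for the initial table `[true]`, the empty sum.
  have := runs_tableLoop (c := c) (B := B + 1) (T := [true]) (ws := ws)
    (by simp only [List.length_singleton]; omega) hend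
  rw [← strs_append, ← hcons] at this
  exact Runs.congr (runs_push_vec.seq (runs_push_tab.seq (runs_push_aux.seq this))) rfl rfl
    (by omega)

theorem length_evens_le : ∀ T : List Bool, (evens T).length ≤ T.length
  | [] => by simp [evens]
  | [_] => by simp [evens]
  | _ :: _ :: l => by simp [evens]; have := length_evens_le l; omega

theorem runs_decimate {T : List Bool} :
    Runs decimate (st i v [] p q (T.map some)) (st i v [] p q ((evens T).map some))
      (6 * T.length + 2) := by
  have h : ∀ (T : List Bool) (o : List Sym),
      Runs (loop .tab never fun a => (push .out a).seq (case .tab fun _ => skip))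
        (st i v o p q (T.map some)) (st i v (((evens T).map some).reverse ++ o) p q [])
        (4 * T.length + 1) := by
    intro T
    induction T using evens.induct with
    | case1 => exact fun o => Runs.loop_nil rfl
    | case2 a =>
      exact fun o => Runs.congr (runs_tab_cons (a := some a) rfl
        (runs_push_out.seq (runs_case_tab (t := []) Runs.skip)) (Runs.loop_nil rfl)) rfl
        (by simp [evens]) (by simp)
    | case3 a b l ih =>
      exact fun o => Runs.congr (runs_tab_cons (a := some a) rfl
        (runs_push_out.seq (runs_case_tab (t := some b :: l.map some) Runs.skip)) (ih _)) rfl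
        (by simp [evens]) (by simp; omega)
  have := length_evens_le T
  exact Runs.congr ((h T []).seq runs_moveAll_out_tab) rfl (by simp)
    (by simp; omega)

theorem runs_lookup {B : ℕ} : ∀ {bs T : List Bool}, T.length ≤ B →
    Runs lookup (st (bs.map some) v [] p q (T.map some))
      (st [] v [] p q ((pick bs T).map some)) (bs.length * (6 * B + 5) + 1)
  | [], T, _ => (Runs.loop_nil rfl).mono (by simp)
  | b :: bs, T, hT => by
    have hd : Runs (dropIf (some b)) (st (bs.map some) v [] p q (T.map some))
        (st (bs.map some) v [] p q ((bif b then T.tail else T).map some)) 2 := by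
      cases b with
      | false => exact Runs.skip.mono (by omega)
      | true => exact (runs_case_tab Runs.skip).congr rfl (by simp) le_rfl
    have hl : (bif b then T.tail else T).length ≤ B := by
      cases b
      · exact hT
      · simp; omega
    have := length_evens_le (bif b then T.tail else T)
    refine Runs.congr (runs_inp_cons (a := some b) rfl (hd.seq runs_decimate)
      (runs_lookup (B := B) (bs := bs) (by omega))) rfl rfl ?_
    simp only [List.length_cons, add_mul]
    omega

theorem runs_finish {P : Option (List Bool)} {T : List Bool} :
    Runs finish (st [] [] [] (P.map fun _ => some true).toList q (T.map some))
      (st [] [] [] [] [] (if P.isSome && T.headD false then [some true] else []))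
      (2 * q.length + 2 * T.length + 6) := by
  cases P with
  | none =>
    exact Runs.congr (runs_clear_aux.seq (runs_case_piv (p := []) (by exact runs_clear_tab))) rfl
      (by simp) (by simp; omega)
  | some w =>
    refine Runs.congr (runs_clear_aux.seq (runs_case_piv (p := [some true])
      (n := 2 * T.length + 3) ?_)) rfl rfl (by omega)
    rcases T with _ | ⟨_ | _, T⟩
    · exact (runs_case_tab (t := []) (by exact runs_clear_tab)).mono (by simp)
    · exact (runs_case_tab (t := some false :: T.map some) (by exact runs_clear_tab)).mono
        (by simp; omega)
    · exact (runs_case_tab (t := some true :: T.map some)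
        (by exact runs_clear_tab.seq runs_push_tab)).mono (by simp; omega)

end Runs

/-! ### The whole program -/

/-- The vectors before the elimination: one for each of `n` variables, and the right-hand sides. -/
def initial (n : ℕ) (rows : List (List Bool)) : List Vec :=
  rows.foldl (fun L bs => addRow bs L) (List.replicate n ([], [true]) ++ [([], [false])])

theorem length_fst_addRow {k : ℕ} {bs : List Bool} {L : List Vec} (hL : ∀ x ∈ L, x.1.length = k) :
    ∀ x ∈ addRow bs L, x.1.length = k + 1 := by
  intro x hx
  obtain ⟨j, hj, rfl⟩ := List.mem_iff_getElem.1 hx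
  simp [addRow, hL]

theorem length_fst_foldl_addRow {k : ℕ} {rows : List (List Bool)} {L : List Vec}
    (hL : ∀ x ∈ L, x.1.length = k) :
    ∀ x ∈ rows.foldl (fun L bs => addRow bs L) L, x.1.length = k + rows.length := by
  induction rows generalizing k L with
  | nil => exact hL
  | cons bs rows ih =>
    intro x hx
    rw [ih (length_fst_addRow hL) x hx, List.length_cons]
    omega

theorem length_fst_initial {n : ℕ} {rows : List (List Bool)} :
    ∀ x ∈ initial n rows, x.1.length = rows.length := by
  have := length_fst_foldl_addRow (k := 0) (rows := rows)
    (L := List.replicate n ([], [true]) ++ [([], [false])]) (by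
      intro x hx
      simp only [List.mem_append, List.mem_replicate, List.mem_singleton] at hx
      rcases hx with ⟨-, rfl⟩ | rfl <;> rfl)
  simpa [initial] using this

theorem runs_main {c : Bool} {n B : ℕ} {rows : List (List Bool)} {bs : List Bool} {ws : List ℕ}
    {P : Option (List Bool)} (hrows : ∀ r ∈ rows, r.length = n + 1)
    (hP : elims rows.length (initial n rows) =
      ws.map ones ++ (P.map fun w => ([], false :: w)).toList)
    (hB : ∀ j ≤ rows.length, (strs (elims j (initial n rows))).length ≤ B)
    (hB₀ : rows.length + bs.length + (3 * n + 3 + rows.length * (n + 1)) ≤ B) :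
    Runs (main c)
      (Function.update (fun _ => []) .inp (List.replicate n (some true) ++ none ::
        (rows.flatMap (fun r => r.map some ++ [none]) ++ none :: bs.map some)))
      (Function.update (fun _ => []) .tab
        (if P.isSome && (pick bs (table c ws [true])).headD false then [some true] else []))
      (100 * (B + 1) ^ 3) := by
  have hst : (fun _ => []) = st [] [] [] [] [] [] := by funext k; cases k <;> rfl
  have hlast := hB _ le_rfl
  rw [hP] at hlast
  have hT : (table c ws [true]).length ≤ B + 1 := by
    have := sum_add_length_ones ws
    rw [length_table]
    simp only [strs_append, List.length_append, List.length_singleton] at hlast ⊢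
    omega
  have hpick : ∀ bs T, (pick bs T).length ≤ T.length := by
    intro bs
    induction bs with
    | nil => simp [pick]
    | cons b bs ih =>
      intro T
      refine (ih _).trans ((length_evens_le _).trans ?_)
      cases b <;> simp
  have hpick := hpick bs (table c ws [true])
  have hstrs : (strs (List.replicate n ([], [true]) ++ [([], [false])])).length = 3 * n + 3 := by
    have : ∀ n, (strs (List.replicate n ([], [true]))).length = 3 * n := by
      intro n
      induction n with
      | zero => rfl
      | succ n ih => simp [List.replicate_succ, length_str, ih]; omega
    simp [this, length_str]
  have h₁ := runs_initVecs (o := []) (p := []) (q := []) (t := [])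
    (i := rows.flatMap (fun r => r.map some ++ [none]) ++ none :: bs.map some) n
  have h₂ := runs_readRows (B := B) (p := []) (q := []) (t := []) (i := bs.map some)
    (rows := rows) (L := List.replicate n ([], [true]) ++ [([], [false])])
    (by simpa using hrows) (by simp) (by rw [hstrs]; simp; omega)
  have h₃ := runs_elimRows (i := bs.map some) (t := []) length_fst_initial hB
  have h₄ := runs_buildTable (i := bs.map some) (c := c) hlast
  rw [← hP] at h₄
  have h₅ := runs_lookup (v := []) (p := (P.map fun _ => some true).toList)
    (q := (table c ws [true]).map some) (bs := bs) hT
  have h₆ := runs_finish (q := (table c ws [true]).map some) (P := P)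
    (T := pick bs (table c ws [true]))
  rw [hst, update_inp, update_tab]
  refine (h₁.seq (h₂.seq (h₃.seq (h₄.seq (h₅.seq h₆))))).mono ?_
  -- The numbers of rows and of bits of `d` are at most `B`; the elimination term `e₂` is the cubic
  -- one.
  have e₁ : rows.length * (8 * B + 3) ≤ B * (8 * B + 3) := Nat.mul_le_mul_right _ (by omega)
  have e₂ : rows.length * (B * (9 * B + 3) + 4 * B + 4) ≤ B * (B * (9 * B + 3) + 4 * B + 4) :=
    Nat.mul_le_mul_right _ (by omega)
  have e₃ : bs.length * (6 * (B + 1) + 5) ≤ B * (6 * (B + 1) + 5) :=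
    Nat.mul_le_mul_right _ (by omega)
  rw [List.length_map]
  nlinarith [Nat.zero_le (B * B * B), Nat.zero_le (B * B), Nat.zero_le B]

/-! ### Correctness of elimination -/

section Reach

/-- Some of the vectors have column bits that sum to `t` and weights of total length `d`. -/
def Reach : List Vec → List Bool → ℕ → Prop
  | [], t, d => (∀ b ∈ t, b = false) ∧ d = 0
  | x :: L, t, d => Reach L t d ∨ ∃ d', d = d' + x.2.length ∧ Reach L (List.zipWith xor t x.1) d'

/-- The number of vectors with column bit `1` at index `j`. -/
def colCount (j : ℕ) (L : List Vec) : ℕ := (L.map fun x => (x.1.getD j false).toNat).sum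

/-- The pivot after the elimination. -/
def pivotOf : Option Vec → List Vec → Option Vec
  | q, [] => q
  | q, ([], _) :: L => pivotOf q L
  | q, (false :: _, _) :: L => pivotOf q L
  | none, (true :: c, w) :: L => pivotOf (some (c, w)) L
  | some y, (true :: _, _) :: L => pivotOf (some y) L

theorem elim_append : ∀ (q : Option Vec) (L L' : List Vec),
    elim q (L ++ L') = elim q L ++ elim (pivotOf q L) L'
  | q, [], L' => by simp [elim, pivotOf]
  | q, ([], _) :: L, L' => by simp [elim, pivotOf, elim_append q L L']
  | q, (false :: _, _) :: L, L' => by simp [elim, pivotOf, elim_append q L L']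
  | none, (true :: c, w) :: L, L' => by simp [elim, pivotOf, elim_append (some (c, w)) L L']
  | some y, (true :: _, _) :: L, L' => by simp [elim, pivotOf, elim_append (some y) L L']

theorem pivotOf_some (y : Vec) : ∀ L : List Vec, pivotOf (some y) L = some y
  | [] => rfl
  | ([], _) :: L => by simp [pivotOf, pivotOf_some y L]
  | (false :: _, _) :: L => by simp [pivotOf, pivotOf_some y L]
  | (true :: _, _) :: L => by simp [pivotOf, pivotOf_some y L]

theorem mem_of_pivotOf {y : Vec} : ∀ {L : List Vec}, pivotOf none L = some y →
    (true :: y.1, y.2) ∈ L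
  | [], h => by simp [pivotOf] at h
  | ([], _) :: L, h => List.mem_cons_of_mem _ (mem_of_pivotOf (L := L) (by simpa [pivotOf] using h))
  | (false :: _, _) :: L, h =>
    List.mem_cons_of_mem _ (mem_of_pivotOf (L := L) (by simpa [pivotOf] using h))
  | (true :: c, w) :: L, h => by
    simp only [pivotOf, pivotOf_some, Option.some.injEq] at h
    subst h
    simp

section Measure

variable {μ μ' : Vec → ℕ}

theorem sum_elim_le_of_colCount_zero (hc : ∀ a c w, μ (c, w) = μ' (a :: c, w)) :
    ∀ {q : Option Vec} {L : List Vec}, colCount 0 L = 0 →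
      ((elim q L).map μ).sum ≤ (L.map μ').sum
  | _, [], _ => by simp [elim]
  | q, ([], w) :: L, h => by
    have := sum_elim_le_of_colCount_zero hc (q := q) (L := L) (by simpa [colCount] using h)
    simp [elim]; omega
  | q, (false :: c, w) :: L, h => by
    have := sum_elim_le_of_colCount_zero hc (q := q) (L := L) (by simpa [colCount] using h)
    simp [elim, hc false c w]; omega
  | q, (true :: c, w) :: L, h => by simp [colCount] at h

theorem sum_elim_some_le (hc : ∀ a c w, μ (c, w) = μ' (a :: c, w))
    (ha : ∀ x y, μ (addVec x y) ≤ μ x + μ y) {y : Vec} :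
    ∀ {L : List Vec}, colCount 0 L ≤ 1 → ((elim (some y) L).map μ).sum ≤ (L.map μ').sum + μ y
  | [], _ => by simp [elim]
  | ([], w) :: L, h => by
    have := sum_elim_some_le hc ha (y := y) (L := L) (by simpa [colCount] using h)
    simp [elim]; omega
  | (false :: c, w) :: L, h => by
    have := sum_elim_some_le hc ha (y := y) (L := L) (by simpa [colCount] using h)
    simp [elim, hc false c w]; omega
  | (true :: c, w) :: L, h => by
    have := sum_elim_le_of_colCount_zero hc (q := some y) (L := L) (by
      simp [colCount] at h ⊢; simpa using h)
    have := ha (c, w) y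
    have := hc true c w
    simp [elim]; omega

/-- The pivot leaves the list and is added to at most one other vector, so a subadditive measure
that ignores the removed first bit cannot increase in total. It is applied both to the bit at a
fixed index and to the length of the weight. -/
theorem sum_elim_none_le (hc : ∀ a c w, μ (c, w) = μ' (a :: c, w))
    (ha : ∀ x y, μ (addVec x y) ≤ μ x + μ y) :
    ∀ {L : List Vec}, colCount 0 L ≤ 2 → ((elim none L).map μ).sum ≤ (L.map μ').sum
  | [], _ => by simp [elim]
  | ([], w) :: L, h => by
    have := sum_elim_none_le hc ha (L := L) (by simpa [colCount] using h)
    simp [elim]; omega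
  | (false :: c, w) :: L, h => by
    have := sum_elim_none_le hc ha (L := L) (by simpa [colCount] using h)
    simp [elim, hc false c w]; omega
  | (true :: c, w) :: L, h => by
    have := sum_elim_some_le hc ha (y := (c, w)) (L := L) (by simp [colCount] at h ⊢; omega)
    have := hc true c w
    simp [elim]; omega

end Measure

/-- Keeps the system 2-affine: the later equations still meet at most two columns each. -/
theorem colCount_elim_le {L : List Vec} (h : colCount 0 L ≤ 2) (j : ℕ) :
    colCount j (elim none L) ≤ colCount (j + 1) L := by
  refine sum_elim_none_le (fun a c w => by simp) (fun x y => ?_) h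
  simp only [addVec, List.getD_eq_getElem?_getD, List.getElem?_zipWith]
  cases x.1[j]? with
  | none => simp
  | some a =>
    cases y.1[j]? with
    | none => simp
    | some b => revert a b; simp

/-- The total weight. -/
def weight (L : List Vec) : ℕ := (L.map fun x => x.2.length).sum

theorem weight_elim_le {L : List Vec} (h : colCount 0 L ≤ 2) : weight (elim none L) ≤ weight L :=
  sum_elim_none_le (fun _ _ _ => rfl) (fun x y => by simp [addVec]) h

theorem length_le_weight {x : Vec} {L : List Vec} (h : x ∈ L) : x.2.length ≤ weight L :=
  List.le_sum_of_mem (List.mem_map_of_mem h)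

/-- Used to see that the weights of columns stay strings of ones. -/
theorem elim_snd {S : List Bool → Prop} (hS : ∀ a b, S a → S b → S (a ++ b)) :
    ∀ {q : Option Vec} {L : List Vec}, (∀ x ∈ q, S x.2) → (∀ x ∈ L, S x.2) →
      ∀ x ∈ elim q L, S x.2
  | _, [], _, _ => by simp [elim]
  | q, ([], w) :: L, hq, h => elim_snd hS (L := L) hq fun x hx => h x (by simp [hx])
  | q, (false :: c, w) :: L, hq, h => by
    have := elim_snd hS (L := L) hq fun x hx => h x (by simp [hx])
    intro x hx
    rcases List.mem_cons.1 hx with rfl | hx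
    · exact h (false :: c, w) (by simp)
    · exact this x hx
  | none, (true :: c, w) :: L, _, h =>
    elim_snd hS (L := L) (by simpa using h (true :: c, w) (by simp)) fun x hx => h x (by simp [hx])
  | some y, (true :: c, w) :: L, hq, h => by
    have := elim_snd hS (L := L) hq fun x hx => h x (by simp [hx])
    intro x hx
    rcases List.mem_cons.1 hx with rfl | hx
    · exact hS _ _ (h (true :: c, w) (by simp)) (hq y rfl)
    · exact this x hx

theorem zipWith_xor_comm (a b : List Bool) : List.zipWith xor a b = List.zipWith xor b a :=
  List.zipWith_comm_of_comm Bool.xor_comm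

theorem zipWith_xor_assoc : ∀ a b c : List Bool,
    List.zipWith xor (List.zipWith xor a b) c = List.zipWith xor a (List.zipWith xor b c)
  | [], _, _ => by simp
  | _ :: _, [], _ => by simp
  | _ :: _, _ :: _, [] => by simp
  | x :: a, y :: b, z :: c => by simp [zipWith_xor_assoc a b c]

theorem zipWith_xor_cancel : ∀ {a b : List Bool}, a.length = b.length →
    List.zipWith xor (List.zipWith xor a b) b = a
  | [], [], _ => rfl
  | x :: a, y :: b, h => by simpa using zipWith_xor_cancel (a := a) (b := b) (by simpa using h)

theorem reach_of_colCount_zero {k : ℕ} : ∀ {q : Option Vec} {L : List Vec} {b : Bool}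
    {t : List Bool} {d : ℕ}, (∀ x ∈ L, x.1.length = k + 1) → colCount 0 L = 0 →
      (Reach L (b :: t) d ↔ b = false ∧ Reach (elim q L) t d)
  | _, [], b, t, d, _, _ => by simp [Reach, elim, and_assoc]
  | q, ([], w) :: L, _, _, _, h, _ => by simpa using h ([], w) (by simp)
  | q, (false :: c, w) :: L, b, t, d, h, h0 => by
    have ih := fun b t d => reach_of_colCount_zero (q := q) (L := L) (b := b) (t := t) (d := d)
      (fun x hx => h x (by simp [hx])) (by simpa [colCount] using h0)
    simp only [Reach, elim, List.zipWith_cons_cons, ih, Bool.xor_false]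
    grind
  | q, (true :: c, w) :: L, _, _, _, _, h => by simp [colCount] at h

/-- Here `y` is the pivot already removed. Either it is not selected and the remaining first bits
must cancel, or it is selected and exactly the one other vector with first bit `1` must be selected
too. The latter is the same as selecting the merged vector. -/
theorem reach_elim_some {k : ℕ} {y : Vec} : ∀ {L : List Vec} {t : List Bool} {d : ℕ},
    (∀ x ∈ L, x.1.length = k + 1) → colCount 0 L ≤ 1 →
      (Reach (elim (some y) L) t d ↔ Reach L (false :: t) d ∨
        ∃ d', d = d' + y.2.length ∧ Reach L (true :: List.zipWith xor t y.1) d')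
  | [], t, d, _, _ => by simp [Reach, elim]
  | ([], w) :: L, _, _, h, _ => by simpa using h ([], w) (by simp)
  | (false :: c, w) :: L, t, d, h, h1 => by
    have ih := fun t d => reach_elim_some (y := y) (L := L) (t := t) (d := d)
      (fun x hx => h x (by simp [hx])) (by simpa [colCount] using h1)
    simp only [Reach, elim, List.zipWith_cons_cons, ih, Bool.xor_false, zipWith_xor_assoc,
      zipWith_xor_comm c]
    constructor
    · rintro ((h | ⟨d', rfl, h⟩) | ⟨d', rfl, h | ⟨d'', rfl, h⟩⟩)
      · exact .inl (.inl h)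
      · exact .inr ⟨d', rfl, .inl h⟩
      · exact .inl (.inr ⟨d', rfl, h⟩)
      · exact .inr ⟨d'' + w.length, by omega, .inr ⟨d'', rfl, h⟩⟩
    · rintro ((h | ⟨d', rfl, h⟩) | ⟨d', rfl, h | ⟨d'', rfl, h⟩⟩)
      · exact .inl (.inl h)
      · exact .inr ⟨d', rfl, .inl h⟩
      · exact .inl (.inr ⟨d', rfl, h⟩)
      · exact .inr ⟨d'' + y.2.length, by omega, .inr ⟨d'', rfl, h⟩⟩
  | (true :: c, w) :: L, t, d, h, h1 => by
    have ih := fun b t d => reach_of_colCount_zero (q := some y) (L := L) (b := b) (t := t) (d := d)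
      (fun x hx => h x (by simp [hx])) (by simp [colCount] at h1 ⊢; simpa using h1)
    simp only [Reach, elim, addVec, List.zipWith_cons_cons, ih, zipWith_xor_assoc,
      zipWith_xor_comm c, Bool.false_xor, Bool.true_xor, Bool.not_true, List.length_append]
    constructor
    · rintro (h | ⟨d', rfl, h⟩)
      · exact .inl (.inl ⟨trivial, h⟩)
      · exact .inr ⟨d' + w.length, by omega, .inr ⟨d', rfl, trivial, h⟩⟩
    · rintro ((⟨-, h⟩ | ⟨d', -, h, -⟩) | ⟨d', rfl, ⟨h, -⟩ | ⟨d'', rfl, -, h⟩⟩)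
      · exact .inl h
      · simp at h
      · simp at h
      · exact .inr ⟨d'', by omega, h⟩

/-- With at most two vectors of first bit `1`, a selection with vanishing first bit contains both or
neither of two, and cannot contain a lone one. So merging two, or dropping one, loses no selection
and keeps total weights exact; with three such vectors the weights would go wrong. -/
theorem reach_elim_none {k : ℕ} : ∀ {L : List Vec} {t : List Bool} {d : ℕ},
    (∀ x ∈ L, x.1.length = k + 1) → colCount 0 L ≤ 2 →
      (Reach (elim none L) t d ↔ Reach L (false :: t) d)
  | [], t, d, _, _ => by simp [Reach, elim]
  | ([], w) :: L, _, _, h, _ => by simpa using h ([], w) (by simp)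
  | (false :: c, w) :: L, t, d, h, h2 => by
    have ih := fun t d => reach_elim_none (L := L) (t := t) (d := d)
      (fun x hx => h x (by simp [hx])) (by simpa [colCount] using h2)
    simp only [Reach, elim, List.zipWith_cons_cons, ih, Bool.xor_false]
  | (true :: c, w) :: L, t, d, h, h2 => by
    have := reach_elim_some (y := (c, w)) (L := L) (t := t) (d := d)
      (fun x hx => h x (by simp [hx])) (by simp [colCount] at h2 ⊢; omega)
    simp only [Reach, elim, List.zipWith_cons_cons, this, Bool.false_xor]

theorem not_reach_of_pivotOf {k : ℕ} : ∀ {L : List Vec} {t : List Bool} {d : ℕ},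
    (∀ x ∈ L, x.1.length = k + 1) → pivotOf none L = none → ¬ Reach L (true :: t) d
  | [], t, d, _, _ => by simp [Reach]
  | ([], w) :: L, _, _, h, _ => by simpa using h ([], w) (by simp)
  | (false :: c, w) :: L, t, d, h, hp => by
    have ih := fun t d => not_reach_of_pivotOf (L := L) (t := t) (d := d)
      (fun x hx => h x (by simp [hx])) (by simpa [pivotOf] using hp)
    simp [Reach, ih]
  | (true :: c, w) :: L, t, d, _, hp => by simp [pivotOf, pivotOf_some] at hp

/-- Toggle the membership of `x` in the selection. The weight changes, so only existence of some
weight is asserted, which is all that satisfiability needs. -/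
theorem exists_reach_add {x : Vec} : ∀ {L : List Vec} {t : List Bool},
    (∀ y ∈ L, y.1.length = t.length) → x ∈ L →
      (∃ d, Reach L t d) → ∃ d, Reach L (List.zipWith xor t x.1) d
  | y :: L, t, hL, hx, h => by
    have hl := hL x hx
    have hy := hL y (by simp)
    have hL' : ∀ y ∈ L, y.1.length = t.length := fun z hz => hL z (by simp [hz])
    simp only [Reach] at h ⊢
    obtain ⟨d, h | ⟨d', rfl, h⟩⟩ := h
    · rcases List.mem_cons.1 hx with rfl | hx
      · exact ⟨d + x.2.length, .inr ⟨d, rfl, by rwa [zipWith_xor_cancel hl.symm]⟩⟩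
      · obtain ⟨d, h⟩ := exists_reach_add (L := L) hL' hx ⟨d, h⟩
        exact ⟨d, .inl h⟩
    · rcases List.mem_cons.1 hx with rfl | hx
      · exact ⟨d', .inl h⟩
      · obtain ⟨d, h⟩ := exists_reach_add (L := L) (by simpa [hy] using hL') hx ⟨d', h⟩
        refine ⟨d + y.2.length, .inr ⟨d, rfl, ?_⟩⟩
        rwa [zipWith_xor_assoc, zipWith_xor_comm x.1, ← zipWith_xor_assoc]

theorem reach_nil_zero : ∀ L : List Vec, Reach L [] 0
  | [] => by simp [Reach]
  | _ :: L => .inl (reach_nil_zero L)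

end Reach

/-! ### Correctness of the table and of binary lookup -/

section Table

theorem getD_orPad : ∀ {T U : List Bool} {k : ℕ}, U.length ≤ T.length →
    (orPad T U).getD k false = (T.getD k false || U.getD k false)
  | [], [], _, _ => by simp [orPad]
  | a :: T, [], _, _ => by simp [orPad]
  | a :: T, b :: U, 0, _ => by simp [orPad]
  | a :: T, b :: U, k + 1, h => by
    simpa [orPad] using getD_orPad (T := T) (U := U) (k := k) (by simpa using h)

/-- A new weight `w` shifts the table by `w` and fills the gap with `c`. For `c = false` this
records exact subset sums; for `c = true` the filled entries record indices exceeded by some sum, so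
the table answers "at least". -/
theorem getD_table {c : Bool} {k : ℕ} : ∀ {ws : List ℕ} {T : List Bool},
    (table c ws T).getD k false = true ↔ ∃ x, Reach (ws.map ones) [] x ∧
      ((x ≤ k ∧ T.getD (k - x) false = true) ∨ (c = true ∧ k < x))
  | [], T => by simp [table, Reach]
  | w :: ws, T => by
    have hg : ∀ m, (orPad (List.replicate w c ++ T) T).getD m false = true ↔
        T.getD m false = true ∨ (w ≤ m ∧ T.getD (m - w) false = true) ∨ (c = true ∧ m < w) := by
      intro m
      rw [getD_orPad (by simp), Bool.or_eq_true, or_comm]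
      refine or_congr_right ?_
      rcases lt_or_ge m w with h | h
      · rw [List.getD_append _ _ _ _ (by simpa using h),
          List.getD_eq_getElem _ _ (by simpa using h)]
        simp [h]
      · rw [List.getD_append_right _ _ _ _ (by simpa using h)]
        simp [h]
    simp only [table, getD_table (ws := ws), hg, List.map_cons, Reach, ones, List.zipWith_nil_left,
      List.length_replicate]
    constructor
    · rintro ⟨x, hx, ⟨hk, h | ⟨hw, h⟩ | ⟨hc, h⟩⟩ | ⟨hc, h⟩⟩
      · exact ⟨x, .inl hx, .inl ⟨hk, h⟩⟩
      · exact ⟨x + w, .inr ⟨x, rfl, hx⟩, .inl ⟨by omega, by rwa [← Nat.sub_sub]⟩⟩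
      · exact ⟨x + w, .inr ⟨x, rfl, hx⟩, .inr ⟨hc, by omega⟩⟩
      · exact ⟨x, .inl hx, .inr ⟨hc, h⟩⟩
    · rintro ⟨x, hx | ⟨x, rfl, hx⟩, ⟨hk, h⟩ | ⟨hc, h⟩⟩
      · exact ⟨x, hx, .inl ⟨hk, .inl h⟩⟩
      · exact ⟨x, hx, .inr ⟨hc, h⟩⟩
      · exact ⟨x, hx, .inl ⟨by omega, .inr (.inl ⟨by omega, by rwa [Nat.sub_sub]⟩)⟩⟩
      · by_cases hk : x ≤ k
        · exact ⟨x, hx, .inl ⟨hk, .inr (.inr ⟨hc, by omega⟩)⟩⟩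
        · exact ⟨x, hx, .inr ⟨hc, by omega⟩⟩

theorem getD_evens : ∀ (T : List Bool) (k : ℕ), (evens T).getD k false = T.getD (2 * k) false
  | [], _ => by simp [evens]
  | [_], 0 => by simp [evens]
  | [_], k + 1 => by simp [evens, Nat.mul_add]
  | _ :: _ :: _, 0 => by simp [evens]
  | _ :: _ :: l, k + 1 => by simpa [evens, Nat.mul_add] using getD_evens l k

/-- Bits come least significant first: dropping an entry for a bit `1` and halving the table turns
index `2 * d + b` into index `d`. Entries past the end count as `false`, so large `d` need no
separate treatment. -/
theorem headD_pick_encodePosNum (d : PosNum) (T : List Bool) :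
    (pick (Computability.encodePosNum d) T).headD false = T.getD d false := by
  have h0 : ∀ T : List Bool, T.headD false = T.getD 0 false := by
    intro T; cases T <;> rfl
  have h1 : ∀ (T : List Bool) k, T.tail.getD k false = T.getD (k + 1) false := by
    intro T k; cases T <;> simp
  induction d generalizing T with
  | one => simp only [Computability.encodePosNum, pick, h0, getD_evens, cond_true, h1]; rfl
  | bit0 d ih =>
    simp only [Computability.encodePosNum, pick, ih, getD_evens, cond_false]
    rw [PosNum.cast_bit0, two_mul]
  | bit1 d ih =>
    simp only [Computability.encodePosNum, pick, ih, getD_evens, cond_true, h1]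
    rw [PosNum.cast_bit1, two_mul]

theorem headD_pick_encodeNat (d : ℕ) (T : List Bool) :
    (pick (Computability.encodeNat d) T).headD false = T.getD d false := by
  unfold Computability.encodeNat
  have h := Num.to_of_nat d
  cases hd : (d : Num) with
  | zero =>
    rw [hd] at h
    obtain rfl : d = 0 := h.symm
    cases T <;> rfl
  | pos p =>
    rw [hd] at h
    have h : (p : ℕ) = d := h
    rw [← h]
    exact headD_pick_encodePosNum p T

end Table

/-! ### Eliminating all equations, with the right-hand side carried along -/

/-- The right-hand side comes last, so it never serves as pivot for a column. If its first bit is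
`1`, either a pivot cancels that bit without affecting solvability, or no column meets the equation,
which then reads `0 = 1`: the vector becomes a pivot itself and vanishes. -/
theorem exists_elim_rhs {k : ℕ} {cols : List Vec} {P : Option Vec}
    (hl : ∀ x ∈ cols, x.1.length = k + 1) (hc : colCount 0 cols ≤ 2)
    (hP : ∀ p ∈ P, p.1.length = k + 1 ∧ ∃ w, p.2 = false :: w) :
    ∃ P' : Option Vec, elim none (cols ++ P.toList) = elim none cols ++ P'.toList ∧
      (∀ p ∈ P', p.1.length = k ∧ ∃ w, p.2 = false :: w) ∧
      (∀ p' ∈ P', ∃ p ∈ P, p'.2.length ≤ p.2.length + weight cols) ∧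
      ((∃ p ∈ P, ∃ d, Reach cols p.1 d) ↔ ∃ p ∈ P', ∃ d, Reach (elim none cols) p.1 d) := by
  rw [elim_append]
  rcases P with _ | ⟨_ | ⟨b, c⟩, w⟩
  · exact ⟨none, by simp [elim], by simp, by simp, by simp⟩
  · simpa using (hP _ rfl).1
  have hp : c.length = k ∧ ∃ w', w = false :: w' := by simpa using hP _ rfl
  obtain ⟨hcl, w', rfl⟩ := hp
  have hreach : ∀ t d, Reach (elim none cols) t d ↔ Reach cols (false :: t) d :=
    fun t d => reach_elim_none hl hc
  cases b with
  | false =>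
    exact ⟨some (c, false :: w'), by simp [elim], by simpa using hcl, by simp, by simp [hreach]⟩
  | true =>
    cases hq : pivotOf none cols with
    | none =>
      refine ⟨none, by simp [elim], by simp, by simp, ?_⟩
      simpa using fun d => not_reach_of_pivotOf hl hq
    | some y =>
      have hy := mem_of_pivotOf hq
      have hyl : y.1.length = k := by simpa using hl _ hy
      have hyw : y.2.length ≤ weight cols := by simpa using length_le_weight hy
      refine ⟨some (addVec (c, false :: w') y), by simp [elim], ?_, ?_, ?_⟩
      · simp [addVec, hcl, hyl]
      · simpa [addVec] using by omega
      · simp only [Option.mem_def, Option.some.injEq, exists_eq_left', addVec, hreach]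
        constructor
        · intro h
          simpa using exists_reach_add (by simpa [hcl] using hl) hy h
        · intro h
          have := exists_reach_add (by simpa [hcl, hyl] using hl) hy h
          simpa [zipWith_xor_cancel (hcl.trans hyl.symm)] using this

/-- Induction on the number of equations. With none left, every selection of columns is allowed, and
a surviving right-hand side is solved by the empty selection. -/
theorem exists_elims : ∀ {k : ℕ} {cols : List Vec} {P : Option Vec},
    (∀ x ∈ cols, x.1.length = k) → (∀ x ∈ cols, ∀ a ∈ x.2, a = true) →
    (∀ j, colCount j cols ≤ 2) → (∀ p ∈ P, p.1.length = k ∧ ∃ w, p.2 = false :: w) →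
    ∃ (ws : List ℕ) (Q : Option (List Bool)),
      elims k (cols ++ P.toList) = ws.map ones ++ (Q.map fun w => ([], false :: w)).toList ∧
      (∀ d, Reach cols (List.replicate k false) d ↔ Reach (ws.map ones) [] d) ∧
      (Q.isSome = true ↔ ∃ p ∈ P, ∃ d, Reach cols p.1 d)
  | 0, cols, P, hl, hw, _, hP => by
    have hcols : cols = (cols.map fun x => x.2.length).map ones := by
      rw [List.map_map]
      refine (List.map_id cols).symm.trans (List.map_congr_left fun x hx => ?_)
      have h1 : x.1 = [] := by simpa using hl x hx
      have h2 : x.2 = List.replicate x.2.length true := List.eq_replicate_iff.2 ⟨rfl, hw x hx⟩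
      exact Prod.ext h1 h2
    refine ⟨cols.map fun x => x.2.length, P.map fun p => p.2.tail, ?_, ?_, ?_⟩
    · rw [← hcols]
      rcases P with _ | ⟨c, w⟩
      · rfl
      · obtain ⟨h1, w', h2⟩ := hP _ rfl
        simp only [List.length_eq_zero_iff] at h1 h2
        subst h1 h2
        rfl
    · rw [← hcols]
      exact fun d => Iff.rfl
    · rcases P with _ | ⟨c, w⟩
      · simp
      · have h1 : c = [] := by simpa using (hP _ rfl).1
        subst h1
        simpa using ⟨0, reach_nil_zero cols⟩
  | k + 1, cols, P, hl, hw, hc, hP => by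
    obtain ⟨P', h₁, h₂, -, h₃⟩ := exists_elim_rhs hl (hc 0) hP
    obtain ⟨ws, Q, h₄, h₅, h₆⟩ := exists_elims (k := k) (cols := elim none cols) (P := P')
      (length_elim_fst hl (by simp))
      (elim_snd (S := fun w => ∀ a ∈ w, a = true)
        (fun a b ha hb x hx => (List.mem_append.1 hx).elim (ha x) (hb x)) (by simp) hw)
      (fun j => (colCount_elim_le (hc 0) j).trans (hc _)) h₂
    refine ⟨ws, Q, ?_, fun d => ?_, ?_⟩
    · rw [elims, h₁, h₄]
    · rw [← h₅, reach_elim_none hl (hc 0), List.replicate_succ]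
    · rw [h₆, h₃]

theorem length_strs (L : List Vec) {k : ℕ} (hl : ∀ x ∈ L, x.1.length = k) :
    (strs L).length = L.length * (k + 2) + weight L := by
  induction L with
  | nil => simp [weight]
  | cons x L ih =>
    have hx := hl x (by simp)
    have := ih fun y hy => hl y (by simp [hy])
    simp only [weight] at this
    simp [weight, length_str, this, add_mul, hx]
    ring

/-- The columns never grow in number or total weight, but each elimination may append a pivot weight
of at most `W` to the right-hand side; this is the source of `k * W`. -/
theorem length_strs_elims_le {N W : ℕ} : ∀ {k j b : ℕ} {cols : List Vec} {P : Option Vec},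
    (∀ x ∈ cols, x.1.length = k) → (∀ j, colCount j cols ≤ 2) →
    (∀ p ∈ P, p.1.length = k ∧ ∃ w, p.2 = false :: w) → cols.length ≤ N → weight cols ≤ W →
    (∀ p ∈ P, p.2.length ≤ b) → j ≤ k →
    (strs (elims j (cols ++ P.toList))).length ≤ N * (k + 2) + W + (k + 2 + b + k * W)
  | k, 0, b, cols, P, hl, hc, hP, hN, hW, hb, _ => by
    have h₁ := length_strs cols hl
    have h₂ : cols.length * (k + 2) ≤ N * (k + 2) := Nat.mul_le_mul_right _ hN
    have h₃ : (strs P.toList).length ≤ k + 2 + b := by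
      cases P with
      | none => simp
      | some p =>
        have h₄ := hP p rfl
        have h₅ := hb p rfl
        simp [length_str]; omega
    simp only [elims, strs_append, List.length_append]
    omega
  | k + 1, j + 1, b, cols, P, hl, hc, hP, hN, hW, hb, hj => by
    obtain ⟨P', h₁, h₂, h₃, -⟩ := exists_elim_rhs hl (hc 0) hP
    have ih := length_strs_elims_le (N := N) (W := W) (k := k) (j := j) (b := b + W)
      (cols := elim none cols) (P := P') (length_elim_fst hl (by simp))
      (fun j => (colCount_elim_le (hc 0) j).trans (hc _)) h₂ ((length_elim_le _ _).trans hN)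
      ((weight_elim_le (hc 0)).trans hW)
      (fun p' hp' => by
        obtain ⟨p, hp, h⟩ := h₃ p' hp'
        have := hb p hp
        omega) (by omega)
    rw [elims, h₁]
    refine ih.trans ?_
    rw [Nat.mul_add N k, Nat.mul_add N (k + 1), Nat.mul_add N k, add_mul k]
    omega

/-! ### From affine formulas to vectors -/

section Formula

open DifferInstance

variable {n : ℕ}

/-- The vectors of a list of equations, most recent equation first: its columns. -/
def columns (φ : List (AffineEquation n)) : List Vec :=
  List.ofFn fun i => (φ.map fun e => bit (e.coeff i), [true])

/-- The vector of the right-hand sides. -/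
def rhsVec (φ : List (AffineEquation n)) : Vec := (φ.map fun e => bit e.rhs, [false])

theorem addRow_append {bs bs' : List Bool} {L L' : List Vec} (h : bs.length = L.length) :
    addRow (bs ++ bs') (L ++ L') = addRow bs L ++ addRow bs' L' :=
  List.zipWith_append h

theorem addRow_ofFn (f : Fin n → Bool) (g : Fin n → Vec) :
    addRow (List.ofFn f) (List.ofFn g) = List.ofFn fun i => (f i :: (g i).1, (g i).2) := by
  apply List.ext_getElem <;> simp [addRow]

theorem addRow_rowBits (e : AffineEquation n) (φ : List (AffineEquation n)) :
    addRow (rowBits e) (columns φ ++ [rhsVec φ]) = columns (e :: φ) ++ [rhsVec (e :: φ)] := by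
  rw [rowBits, columns, addRow_append (by simp), addRow_ofFn]
  rfl

/-- Each row read is put in front of the earlier ones, hence the reversed order of the equations. -/
theorem initial_eq (φ : AffineFormula n) :
    initial n (φ.map rowBits) = columns φ.reverse ++ [rhsVec φ.reverse] := by
  have h : ∀ φ ψ : List (AffineEquation n),
      (φ.map rowBits).foldl (fun L bs => addRow bs L) (columns ψ ++ [rhsVec ψ]) =
        columns (φ.reverse ++ ψ) ++ [rhsVec (φ.reverse ++ ψ)] := by
    intro φ
    induction φ with
    | nil => simp
    | cons e φ ih => intro ψ; simp [addRow_rowBits, ih]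
  have h₀ : columns ([] : List (AffineEquation n)) ++ [rhsVec ([] : List (AffineEquation n))] =
      List.replicate n ([], [true]) ++ [([], [false])] := by
    simp [columns, rhsVec, List.ofFn_const]
  rw [initial, ← h₀, h, List.append_nil]

theorem bit_add (a b : ZMod 2) : bit (a + b) = xor (bit a) (bit b) := by
  revert a b; unfold bit; decide

/-- A selection of columns is the support of an assignment `u`, and all weights are 1. The induction
splits on whether the first variable is 0 or 1; in the latter case its column moves to the
right-hand side. -/
theorem reach_ofFn {α : Type} (ψ : List α) : ∀ {n : ℕ} (g : Fin n → α → ZMod 2) (f : α → ZMod 2)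
    (d : ℕ), Reach (List.ofFn fun i => (ψ.map fun e => bit (g i e), [true]))
      (ψ.map fun e => bit (f e)) d ↔
      ∃ u : Fin n → ZMod 2, (∀ e ∈ ψ, ∑ i, g i e * u i = f e) ∧ hammingNorm u = d
  | 0, g, f, d => by
    have hb : ∀ a : ZMod 2, bit a = false ↔ a = 0 := by unfold bit; decide
    simp only [Reach, List.ofFn_zero, List.forall_mem_map, hb, Finset.univ_eq_empty,
      Finset.sum_empty, hammingNorm, Finset.filter_empty, Finset.card_empty, exists_const]
    constructor <;> rintro ⟨h₁, h₂⟩ <;> exact ⟨fun e he => (h₁ e he).symm, h₂.symm⟩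
  | n + 1, g, f, d => by
    have h₁ : List.zipWith xor (ψ.map fun e => bit (f e)) (ψ.map fun e => bit (g 0 e)) =
        ψ.map fun e => bit (f e + g 0 e) := by
      simp only [bit_add, List.zipWith_map, List.zipWith_self]
    have hnorm : ∀ (a : ZMod 2) (u : Fin n → ZMod 2),
        hammingNorm (Fin.cons a u : Fin (n + 1) → ZMod 2) =
          hammingNorm u + if a = 0 then 0 else 1 := by
      intro a u
      simp only [hammingNorm, Finset.card_filter, Fin.sum_univ_succ, Fin.cons_zero, Fin.cons_succ]
      by_cases ha : a = 0 <;> simp [ha, add_comm]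
    have hadd : ∀ a b c : ZMod 2, c = a + b ↔ b + c = a := by decide
    rw [List.ofFn_succ]
    simp only [Reach, h₁, reach_ofFn ψ (fun i => g i.succ) f, List.length_singleton,
      reach_ofFn ψ (fun i => g i.succ) (fun e => f e + g 0 e)]
    constructor
    · rintro (⟨u, hu, rfl⟩ | ⟨d', rfl, u, hu, rfl⟩)
      · exact ⟨Fin.cons 0 u, fun e he => by simp [Fin.sum_univ_succ, hu e he], by simp [hnorm]⟩
      · refine ⟨Fin.cons 1 u, fun e he => ?_, by simp [hnorm]⟩
        have := (hadd _ _ _).1 (hu e he)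
        simpa [Fin.sum_univ_succ] using this
    · rintro ⟨u, hu, rfl⟩
      obtain ⟨a, u, rfl⟩ : ∃ a u', u = Fin.cons a u' := ⟨u 0, Fin.tail u, by simp⟩
      have ha : a = 0 ∨ a = 1 := (by decide : ∀ a : ZMod 2, a = 0 ∨ a = 1) a
      rcases ha with rfl | rfl
      · exact .inl ⟨u, fun e he => by simpa [Fin.sum_univ_succ] using hu e he, by simp [hnorm]⟩
      · refine .inr ⟨_, by simp [hnorm], u, fun e he => (hadd _ _ _).2 ?_, rfl⟩
        simpa [Fin.sum_univ_succ] using hu e he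

theorem colCount_columns_le {ψ : List (AffineEquation n)} (h : ∀ e ∈ ψ, e.vars.card ≤ 2) (j : ℕ) :
    colCount j (columns ψ) ≤ 2 := by
  simp only [colCount, columns, List.map_ofFn, List.sum_ofFn, Function.comp_def]
  by_cases hj : j < ψ.length
  · refine le_of_eq_of_le ?_ (h ψ[j] (List.getElem_mem hj))
    have hb : ∀ a : ZMod 2, (bit a).toNat = if a ≠ 0 then 1 else 0 := by unfold bit; decide
    rw [AffineEquation.vars, Finset.card_filter]
    refine Finset.sum_congr rfl fun i _ => ?_
    rw [List.getD_eq_getElem _ _ (by simpa using hj), List.getElem_map, hb]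
  · refine le_of_eq_of_le (Finset.sum_eq_zero fun i _ => ?_) (Nat.zero_le 2)
    rw [List.getD_eq_default _ _ (by simpa using hj)]
    rfl

/-- The problem that the program decides. -/
def Differ (c : Bool) (I : DifferInstance) : Prop :=
  ∃ s t : Fin I.n → ZMod 2, I.formula.SatisfiedBy s ∧ I.formula.SatisfiedBy t ∧
    (hammingDist s t = I.d ∨ c = true ∧ I.d < hammingDist s t)

/-- Differences of solutions are exactly the homogeneous solutions once a solution `s` exists: pass
from `(s, t)` to `-s + t` and back from `u` to `(s, s + u)`. -/
theorem differ_iff (c : Bool) (I : DifferInstance) : Differ c I ↔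
    (∃ d, Reach (columns I.formula.reverse) (rhsVec I.formula.reverse).1 d) ∧
      ∃ d, Reach (columns I.formula.reverse) (List.replicate I.formula.length false) d ∧
        (d = I.d ∨ c = true ∧ I.d < d) := by
  have h₀ : List.replicate I.formula.length false =
      I.formula.reverse.map fun _ => bit (0 : ZMod 2) := by
    rw [List.map_const', List.length_reverse]
    rfl
  rw [h₀]
  simp only [columns, rhsVec, reach_ofFn I.formula.reverse (fun i e => e.coeff i)
    (fun e => e.rhs), reach_ofFn I.formula.reverse (fun i e => e.coeff i) (fun _ => 0),
    List.mem_reverse]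
  constructor
  · rintro ⟨s, t, hs, ht, h⟩
    refine ⟨⟨_, s, hs, rfl⟩, _, ⟨-s + t, fun e he => ?_, rfl⟩,
      by rwa [← hammingDist_eq_hammingNorm]⟩
    have h₁ := hs e he
    have h₂ := ht e he
    simp only [AffineEquation.SatisfiedBy] at h₁ h₂
    simp [mul_add, Finset.sum_add_distrib, h₁, h₂, CharTwo.add_self_eq_zero]
  · rintro ⟨⟨_, s, hs, -⟩, _, ⟨u, hu, rfl⟩, h⟩
    refine ⟨s, s + u, hs, fun e he => ?_,
      by rwa [hammingDist_eq_hammingNorm, neg_add_cancel_left]⟩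
    have h₁ := hs e he
    have h₂ := hu e he
    simp [AffineEquation.SatisfiedBy, mul_add, Finset.sum_add_distrib, h₁, h₂]

end Formula

/-! ### Polynomial-time solvability -/

section Main

open DifferInstance

theorem length_encode (I : DifferInstance) : (encode I).length =
    I.n + I.formula.length * (I.n + 2) + (Computability.encodeNat I.d).length + 2 := by
  have : ∀ φ : AffineFormula I.n,
      (φ.flatMap fun e => (rowBits e).map some ++ [none]).length = φ.length * (I.n + 2) := by
    intro φ
    induction φ with
    | nil => simp
    | cons e φ ih =>
      rw [List.flatMap_cons, List.length_append, ih]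
      simp [rowBits]; ring
  simp only [encode, List.length_append, List.length_replicate, List.length_cons, this,
    List.length_map]
  ring

theorem exists_runs_main (c : Bool) (I : TwoAffineInstance) : ∃ r : Bool,
    (r = true ↔ Differ c I.1) ∧
    StackProg.Runs (main c) (Function.update (fun _ => []) .inp I.1.encode)
      (Function.update (fun _ => []) .tab (if r then [some true] else []))
      (100 * (10 * (I.1.encode.length + 1) ^ 2 + 1) ^ 3) := by
  obtain ⟨I, hI⟩ := I
  have hl : ∀ x ∈ columns I.formula.reverse, x.1.length = I.formula.length := by
    simp [columns, List.mem_ofFn]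
  have hw : ∀ x ∈ columns I.formula.reverse, ∀ a ∈ x.2, a = true := by
    simp [columns, List.mem_ofFn]
  have hc := colCount_columns_le (ψ := I.formula.reverse) fun e he => hI e (by simpa using he)
  have hP : ∀ p ∈ some (rhsVec I.formula.reverse), p.1.length = I.formula.length ∧
      ∃ w, p.2 = false :: w := by
    simp [rhsVec]
  have hweight : weight (columns I.formula.reverse) = I.n := by
    simp [weight, columns, Function.comp_def]
  obtain ⟨ws, Q, h₁, h₂, h₃⟩ := exists_elims hl hw hc hP
  have hB := fun j hj => length_strs_elims_le (N := I.n) (W := I.n) (b := 1) (j := j) hl hc hP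
    (by simp [columns]) hweight.le (by simp [rhsVec]) hj
  have hi : initial I.n (I.formula.map rowBits) =
      columns I.formula.reverse ++ (some (rhsVec I.formula.reverse)).toList := initial_eq _
  rw [← hi] at h₁
  simp only [← hi] at hB
  refine ⟨Q.isSome && (pick (Computability.encodeNat I.d) (table c ws [true])).headD false, ?_, ?_⟩
  · have h₄ : ∀ k, [true].getD k false = true ↔ k = 0 := by
      intro k
      cases k <;> simp
    rw [Bool.and_eq_true, h₃, headD_pick_encodeNat, getD_table, differ_iff]
    simp only [h₂, h₄, Option.mem_def, Option.some.injEq, exists_eq_left']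
    refine and_congr_right fun _ => exists_congr fun x => and_congr_right fun _ =>
      or_congr_left ?_
    omega
  · have hlen := length_encode I
    -- Since `l` already contains the product `m * n` of the matrix dimensions, both quantities are
    -- linear in `l`; the square leaves ample room.
    have harith : ∀ l m n b : ℕ, l = n + m * (n + 2) + b + 2 →
        n * (m + 2) + n + (m + 2 + 1 + m * n) ≤ 10 * (l + 1) ^ 2 ∧
          m + b + (3 * n + 3 + m * (n + 1)) ≤ 10 * (l + 1) ^ 2 := by
      intro l m n b h
      have h₁ : l + 1 ≤ (l + 1) ^ 2 := Nat.le_self_pow (by omega) _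
      rw [mul_add] at h
      constructor
      · rw [mul_add, mul_comm n m]
        omega
      · rw [mul_add]
        omega
    have h₅ := runs_main (c := c) (n := I.n) (B := 10 * (I.encode.length + 1) ^ 2)
      (rows := I.formula.map rowBits) (bs := Computability.encodeNat I.d) (ws := ws) (P := Q)
      (by simp [rowBits]) (by simpa using h₁)
      (fun j hj => (hB j (by simpa using hj)).trans ?_) ?_
    · simpa [encode, List.flatMap_map] using h₅
    · exact (harith _ _ _ _ hlen).1
    · rw [List.length_map]
      exact (harith _ _ _ _ hlen).2

theorem polyTimeSolvable_differ (c : Bool) :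
    PolyTimeSolvable (fun I : TwoAffineInstance => I.1.encode) (fun I => Differ c I.1) := by
  choose f hf hruns using exists_runs_main c
  refine ⟨f, hf, ⟨?_⟩⟩
  refine
    { tm := StackProg.machine (main c) .inp .tab fun a => decide (a = some (some true))
      inputAlphabet := Equiv.refl _
      outputAlphabet := Equiv.refl _
      time := 100 * (10 * (Polynomial.X + 1) ^ 2 + 1) ^ 3 + 1
      outputsFun := fun I => Classical.choice ?_ }
  have h := StackProg.machine_outputs (main c) .inp .tab (fun a => decide (a = some (some true)))
    I.1.encode (if f I then [some true] else []) (hruns I) (by cases f I <;> rfl)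
  have h₁ : ∀ w : List Sym, w = I.1.encode → Nonempty (Turing.TM2OutputsInTime
      (StackProg.machine (main c) .inp .tab fun a => decide (a = some (some true)))
      w (some (Computability.encodeBool (f I)))
      (100 * (10 * (I.1.encode.length + 1) ^ 2 + 1) ^ 3 + 1)) := by
    rintro _ rfl
    cases hr : f I <;> rw [hr] at h <;> exact h
  have h₂ : (100 * (10 * (Polynomial.X + 1) ^ 2 + 1) ^ 3 + 1 : Polynomial ℕ).eval
      I.1.encode.length = 100 * (10 * (I.1.encode.length + 1) ^ 2 + 1) ^ 3 + 1 := by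
    simp
  rw [h₂]
  exact h₁ (List.map id _) (List.map_id _)

end Main

end DifferMachine

theorem mainTheorem8 :
    PolyTimeSolvable (fun I : TwoAffineInstance => I.1.encode) (fun I => I.1.ExactDiffer) ∧
      PolyTimeSolvable (fun I : TwoAffineInstance => I.1.encode) (fun I => I.1.MaxDiffer) := by
  constructor
  · convert DifferMachine.polyTimeSolvable_differ false using 2 with I
    simp [DifferMachine.Differ, DifferInstance.ExactDiffer]
  · convert DifferMachine.polyTimeSolvable_differ true using 2 with I
    simp [DifferMachine.Differ, DifferInstance.MaxDiffer, le_iff_eq_or_lt, eq_comm]
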